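/- For $b_1,\dots,b_n>0$ let $E^{2n}(b_1,\dots,b_n)=\{z\in\mathbb C^n : \sum_{i=1}^n \pi|z_i|^2/b_i<1\}$ be the open symplectic ellipsoid, and for $b>0$ let $B^{2n}(b)=E^{2n}(b,\dots,b)$ be the open ball. Both carry the standard symplectic form $\omega_0=\sum_{i=1}^n dx_i\wedge dy_i$, where $z_i=x_i+iy_i$. For open $U,V\subset\mathbb C^n$, we say that $U$ symplectically embeds in $V$ if there is a smooth embedding $\varphi\colon U\hookrightarrow V$ with $\varphi^*\omega_0=\omega_0$. Let $n\ge 2$. (1) For all $a>2\pi$ and $\varepsilon>0$, the ellipsoid $E^{2n}(\pi,\dots,\pi,a)$ symplectically embeds in $B^{2n}\left(\frac a2+\pi+\varepsilon\right)$. (2) Consequently, the condition $a_n\le 2a_1$ cannot be weakened to $a_n\le\kappa a_1$ with any $\kappa>2$ in the theorem "if $0<a_1\le\dots\le a_n\le 2a_1$ and $0<A<a_n$, then $E^{2n}(a_1,\dots,a_n)$ does not symplectically embed in $B^{2n}(A)$". More precisely, for all $a_1>0$ and $a_n>2a_1$ there is a real number $A$ with $0<A<a_n$ such that $E^{2n}(a_1,\dots,a_1,a_n)$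 symplectically embeds in $B^{2n}(A)$. -/

import Mathlib

open scoped ContDiff

namespace SymplecticFolding

/-- The standard symplectic form `ω₀ = ∑ dxᵢ ∧ dyᵢ` on `ℂⁿ = ℝ²ⁿ`, with `zᵢ = xᵢ + i yᵢ`. -/
def omega {n : ℕ} (v w : Fin n → ℂ) : ℝ :=
  ∑ i, ((v i).re * (w i).im - (v i).im * (w i).re)

/-- The open symplectic ellipsoid `E(a₁, …, aₙ) = {z ∈ ℂⁿ | ∑ π |zᵢ|² / aᵢ < 1}`
(meaningful for positive `aᵢ`). -/
def ellipsoid {n : ℕ} (a : Fin n → ℝ) : Set (Fin n → ℂ) :=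
  {z | ∑ i, Real.pi * ‖z i‖ ^ 2 / a i < 1}

/-- The ellipsoid `E²ⁿ(b, …, b, c)`: all parameters are `b`, except the last one, which is `c`. -/
def ellipsoidLast (n : ℕ) (b c : ℝ) : Set (Fin n → ℂ) :=
  ellipsoid (fun i : Fin n => if (i : ℕ) + 1 = n then c else b)

/-- The ball `B²ⁿ(a) = E²ⁿ(a, …, a)`. -/
def ball (n : ℕ) (a : ℝ) : Set (Fin n → ℂ) :=
  ellipsoid (fun _ : Fin n => a)

/-- Ellipsoids are open, so that the derivative at their points is the usual one. -/
theorem isOpen_ellipsoid {n : ℕ} (a : Fin n → ℝ) : IsOpen (ellipsoid a) :=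
  isOpen_lt (by fun_prop) continuous_const

/-- `φ` restricts to a symplectic embedding of the open set `U` into `V`: a smooth map that is a
homeomorphism of `U` onto its image, lies in `V`, and satisfies `φ^* ω₀ = ω₀` on `U`.
(That `φ` is an immersion follows from the last condition, as `ω₀` is nondegenerate.) -/
structure IsSymplecticEmbedding {n : ℕ} (φ : (Fin n → ℂ) → (Fin n → ℂ))
    (U V : Set (Fin n → ℂ)) : Prop where
  isOpen_source : IsOpen U
  contDiffOn : ContDiffOn ℝ ∞ φ U
  isEmbedding : Topology.IsEmbedding (U.domRestrict φ)
  mapsTo : Set.MapsTo φ U V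
  pullback_omega : ∀ z ∈ U, ∀ v w : Fin n → ℂ,
    omega (fderiv ℝ φ z v) (fderiv ℝ φ z w) = omega v w

/-- `U` symplectically embeds in `V`. -/
def SymplecticallyEmbeds {n : ℕ} (U V : Set (Fin n → ℂ)) : Prop :=
  ∃ φ : (Fin n → ℂ) → (Fin n → ℂ), IsSymplecticEmbedding φ U V

end SymplecticFolding

/-!
This is symplectic folding. An area preserving embedding of the plane into a slit plane, followed
by polar coordinates `(π r², θ / 2π)`, turns `E⁴(b, c)` up to a small error into the set of points
`((x, y), (u, v))` with `y, v ∈ (0, 1)` and `0 < x < b (1 - u / c)`. Over the half `c / 2 < u < c`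
of the base the fibres are shorter than `b / 2`. A shear moves the fibres over the other half by
`b / 2` in the `x`-direction, at the cost of some area in the base; then the base is folded, so
that both halves come to lie over an interval of length about `(b + c) / 2`, with `x + u` at most
about `c / 2 + b`; this is the ball `B⁴(c / 2 + b)` in polar coordinates.

To return from strips to the plane, points whose second angles differ by `1` must not collide. This
is arranged by stretching the base by a factor slightly larger than `1`, and by a very large factor
near the fold: the strip then has width less than `Λ⁻¹` everywhere and less than `N⁻¹` near the
fold, where `Λ⁻¹ + N⁻¹ = 1`.

In higher dimensions the remaining coordinates are left fixed.
-/

namespace SymplecticFolding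

open Filter Topology

/-! ### Pulling back skew forms -/

section PullsBackAt

variable {E F G : Type*} [NormedAddCommGroup E] [NormedSpace ℝ E] [NormedAddCommGroup F]
  [NormedSpace ℝ F] [NormedAddCommGroup G] [NormedSpace ℝ G]

/-- `f` is smooth at `z` and `f^* Ω' = Ω` there. Forms are bare functions of two vectors, so that
`omega` is one of them; a form varying from point to point is represented by its value at `z`. -/
structure PullsBackAt (f : E → F) (Ω' : F → F → ℝ) (Ω : E → E → ℝ) (z : E) : Prop where
  contDiffAt : ContDiffAt ℝ ∞ f z
  form_fderiv : ∀ v w, Ω' (fderiv ℝ f z v) (fderiv ℝ f z w) = Ω v w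

variable {f : E → F} {Ω : E → E → ℝ} {Ω' : F → F → ℝ} {Ω'' : G → G → ℝ} {z : E}

theorem PullsBackAt.of_hasFDerivAt {L : E →L[ℝ] F} (hf : ContDiffAt ℝ ∞ f z)
    (hL : HasFDerivAt f L z) (h : ∀ v w, Ω' (L v) (L w) = Ω v w) : PullsBackAt f Ω' Ω z :=
  ⟨hf, by rwa [hL.fderiv]⟩

theorem PullsBackAt.hasStrictFDerivAt (h : PullsBackAt f Ω' Ω z) :
    HasStrictFDerivAt f (fderiv ℝ f z) z :=
  h.contDiffAt.hasStrictFDerivAt (by simp)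

theorem PullsBackAt.hasFDerivAt (h : PullsBackAt f Ω' Ω z) : HasFDerivAt f (fderiv ℝ f z) z :=
  h.hasStrictFDerivAt.hasFDerivAt

theorem pullsBackAt_id : PullsBackAt id Ω Ω z :=
  .of_hasFDerivAt contDiffAt_id (hasFDerivAt_id z) fun _ _ => rfl

theorem PullsBackAt.const_add (h : PullsBackAt f Ω' Ω z) (a : F) :
    PullsBackAt (fun x => a + f x) Ω' Ω z :=
  ⟨contDiffAt_const.add h.contDiffAt, by simpa only [fderiv_const_add] using h.form_fderiv⟩

theorem PullsBackAt.comp {g : F → G} (hg : PullsBackAt g Ω'' Ω' (f z))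
    (hf : PullsBackAt f Ω' Ω z) : PullsBackAt (g ∘ f) Ω'' Ω z :=
  .of_hasFDerivAt (hg.contDiffAt.comp z hf.contDiffAt) (hg.hasFDerivAt.comp z hf.hasFDerivAt)
    fun v w => by simp only [ContinuousLinearMap.comp_apply, hg.form_fderiv, hf.form_fderiv]

theorem PullsBackAt.of_eventually_rightInverse {g : F → E} {y : F}
    (hf : PullsBackAt f Ω' Ω (g y)) (hg : ContDiffAt ℝ ∞ g y) (hfg : ∀ᶠ x in 𝓝 y, f (g x) = x) :
    PullsBackAt g Ω Ω' y := by
  have hg' : HasFDerivAt g (fderiv ℝ g y) y := (hg.differentiableAt (by simp)).hasFDerivAt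
  have hchain : (fderiv ℝ f (g y)).comp (fderiv ℝ g y) = ContinuousLinearMap.id ℝ F :=
    (hf.hasFDerivAt.comp y hg').unique ((hasFDerivAt_id y).congr_of_eventuallyEq hfg)
  refine ⟨hg, fun v w => ?_⟩
  rw [← hf.form_fderiv, ← ContinuousLinearMap.comp_apply, ← ContinuousLinearMap.comp_apply, hchain]
  rfl

theorem PullsBackAt.injective_fderiv (h : PullsBackAt f Ω' Ω z) (hΩ' : ∀ w, Ω' 0 w = 0)
    (hΩ : ∀ v, (∀ w, Ω v w = 0) → v = 0) : Function.Injective (fderiv ℝ f z) :=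
  (injective_iff_map_eq_zero _).2 fun v hv => hΩ v fun w => by rw [← h.form_fderiv, hv, hΩ']

end PullsBackAt

section Inverse

variable {E F : Type*} [NormedAddCommGroup E] [NormedSpace ℝ E] [NormedAddCommGroup F]
  [NormedSpace ℝ F]

theorem isOpenEmbedding_domRestrict_of_hasStrictFDerivAt [CompleteSpace E] [CompleteSpace F]
    {f : E → F} {f' : E → E →L[ℝ] F} {U : Set E} (hU : IsOpen U) (hinj : U.InjOn f)
    (hf : ∀ z ∈ U, HasStrictFDerivAt f (f' z) z) (hf' : ∀ z ∈ U, Function.Surjective (f' z)) :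
    Topology.IsOpenEmbedding (U.domRestrict f) := by
  have hcont : ContinuousOn f U := fun z hz => (hf z hz).continuousAt.continuousWithinAt
  refine .of_continuous_injective_isOpenMap (continuousOn_iff_continuous_domRestrict.1 hcont)
    (Set.injOn_iff_injective.1 hinj) (isOpenMap_iff_nhds_le.2 ?_)
  rintro ⟨z, hz⟩
  have hmap : map f (𝓝 z) = 𝓝 (f z) :=
    (hf z hz).map_nhds_eq_of_surj (LinearMap.range_eq_top.2 (hf' z hz))
  change 𝓝 (f z) ≤ map (f ∘ Subtype.val) (𝓝 (⟨z, hz⟩ : U))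
  rw [← Filter.map_map, map_nhds_subtype_coe_eq_nhds hz (hU.mem_nhds hz), hmap]

theorem contDiffAt_of_rightInverse [FiniteDimensional ℝ E] {f g : E → E} {y : E}
    (hinj : Function.Injective f) (hfg : Function.RightInverse g f)
    (hf : ContDiffAt ℝ ∞ f (g y)) (hf' : Function.Injective (fderiv ℝ f (g y))) :
    ContDiffAt ℝ ∞ g y := by
  have : CompleteSpace E := FiniteDimensional.complete ℝ E
  let f' : E ≃L[ℝ] E := (LinearEquiv.ofInjectiveEndo _ hf').toContinuousLinearEquiv
  have hf'f : HasFDerivAt f (f' : E →L[ℝ] E) (g y) :=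
    (hf.differentiableAt (by simp)).hasFDerivAt
  have hlocal := hf.to_localInverse hf'f (by simp)
  have hright := (hf.hasStrictFDerivAt' hf'f (by simp)).eventually_right_inverse
  rw [hfg y] at hlocal hright
  exact hlocal.congr_of_eventuallyEq (hright.mono fun x hx => hinj ((hfg x).trans hx.symm))

end Inverse

/-! ### Symplectic forms on `ℂ`, `ℂ × ℂ` and `ℂⁿ` -/

section Forms

/-- The area form `dx ∧ dy` on `ℂ`. -/
def areaForm (v w : ℂ) : ℝ := v.re * w.im - v.im * w.re

/-- The standard symplectic form `dx₁ ∧ dy₁ + dx₂ ∧ dy₂` on `ℂ × ℂ`. -/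
def prodForm (v w : ℂ × ℂ) : ℝ := areaForm v.1 w.1 + areaForm v.2 w.2

theorem areaForm_zero_left (w : ℂ) : areaForm 0 w = 0 := by simp [areaForm]

theorem eq_zero_of_areaForm_eq_zero {v : ℂ} (h : ∀ w, areaForm v w = 0) : v = 0 := by
  have hre := h Complex.I
  have him := h 1
  simp only [areaForm, Complex.I_re, Complex.I_im, Complex.one_re, Complex.one_im, mul_one,
    mul_zero, sub_zero, zero_sub, neg_eq_zero] at hre him
  exact Complex.ext hre him

theorem omega_single {n : ℕ} (v : Fin n → ℂ) (i : Fin n) (w : ℂ) :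
    omega v (Pi.single i w) = areaForm (v i) w := by
  refine (Finset.sum_eq_single i (fun j _ hj => ?_) (by simp)).trans ?_
  · simp [Pi.single_eq_of_ne hj]
  · simp [areaForm]

theorem eq_zero_of_omega_eq_zero {n : ℕ} {v : Fin n → ℂ} (h : ∀ w, omega v w = 0) : v = 0 :=
  funext fun i => eq_zero_of_areaForm_eq_zero fun w => by rw [← omega_single, h]

variable {E : Type*} [NormedAddCommGroup E] [NormedSpace ℝ E]

@[fun_prop]
theorem contDiff_re {n : ℕ∞ω} : ContDiff ℝ n Complex.re := Complex.reCLM.contDiff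

@[fun_prop]
theorem contDiff_im {n : ℕ∞ω} : ContDiff ℝ n Complex.im := Complex.imCLM.contDiff

theorem hasFDerivAt_re (z : ℂ) : HasFDerivAt Complex.re Complex.reCLM z :=
  Complex.reCLM.hasFDerivAt

theorem hasFDerivAt_im (z : ℂ) : HasFDerivAt Complex.im Complex.imCLM z :=
  Complex.imCLM.hasFDerivAt

theorem hasFDerivAt_complex_mk {a b : E → ℝ} {A B : E →L[ℝ] ℝ} {z : E} (hA : HasFDerivAt a A z)
    (hB : HasFDerivAt b B z) : HasFDerivAt (fun x => (⟨a x, b x⟩ : ℂ))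
      ((Complex.equivRealProdCLM.symm : ℝ × ℝ →L[ℝ] ℂ).comp (A.prod B)) z :=
  (Complex.equivRealProdCLM.symm : ℝ × ℝ →L[ℝ] ℂ).hasFDerivAt.comp z (hA.prodMk hB)

theorem contDiffAt_complex_mk {a b : E → ℝ} {z : E} (ha : ContDiffAt ℝ ∞ a z)
    (hb : ContDiffAt ℝ ∞ b z) : ContDiffAt ℝ ∞ (fun x => (⟨a x, b x⟩ : ℂ)) z :=
  (Complex.equivRealProdCLM.symm : ℝ × ℝ →L[ℝ] ℂ).contDiff.contDiffAt.comp z (ha.prodMk hb)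

theorem pullsBackAt_complex_mk {Ω : E → E → ℝ} {a b : E → ℝ} {A B : E →L[ℝ] ℝ} {z : E}
    (ha : ContDiffAt ℝ ∞ a z) (hb : ContDiffAt ℝ ∞ b z) (hA : HasFDerivAt a A z)
    (hB : HasFDerivAt b B z) (h : ∀ v w, A v * B w - B v * A w = Ω v w) :
    PullsBackAt (fun x => (⟨a x, b x⟩ : ℂ)) areaForm Ω z :=
  .of_hasFDerivAt (contDiffAt_complex_mk ha hb) (hasFDerivAt_complex_mk hA hB) h

theorem PullsBackAt.prodMk {f g : E → ℂ} {Ω₁ Ω₂ : E → E → ℝ} {z : E}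
    (hf : PullsBackAt f areaForm Ω₁ z) (hg : PullsBackAt g areaForm Ω₂ z) :
    PullsBackAt (fun x => (f x, g x)) prodForm (Ω₁ + Ω₂) z :=
  .of_hasFDerivAt (hf.contDiffAt.prodMk hg.contDiffAt) (hf.hasFDerivAt.prodMk hg.hasFDerivAt)
    fun v w => congrArg₂ (· + ·) (hf.form_fderiv v w) (hg.form_fderiv v w)

theorem PullsBackAt.prodMap {f g : ℂ → ℂ} {z : ℂ × ℂ} (hf : PullsBackAt f areaForm areaForm z.1)
    (hg : PullsBackAt g areaForm areaForm z.2) :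
    PullsBackAt (Prod.map f g) prodForm prodForm z := by
  have hfst : PullsBackAt Prod.fst areaForm (fun v w : ℂ × ℂ => areaForm v.1 w.1) z :=
    .of_hasFDerivAt contDiffAt_fst hasFDerivAt_fst fun _ _ => rfl
  have hsnd : PullsBackAt Prod.snd areaForm (fun v w : ℂ × ℂ => areaForm v.2 w.2) z :=
    .of_hasFDerivAt contDiffAt_snd hasFDerivAt_snd fun _ _ => rfl
  exact (hf.comp hfst).prodMk (hg.comp hsnd)

end Forms

section Embedding

variable {n : ℕ}

theorem isSymplecticEmbedding_of_pullsBackAt {f : (Fin n → ℂ) → Fin n → ℂ}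
    {U V : Set (Fin n → ℂ)} (hU : IsOpen U) (hf : ∀ z ∈ U, PullsBackAt f omega omega z)
    (hinj : U.InjOn f) (hmaps : U.MapsTo f V) : IsSymplecticEmbedding f U V where
  isOpen_source := hU
  contDiffOn z hz := (hf z hz).contDiffAt.contDiffWithinAt
  isEmbedding := by
    refine (isOpenEmbedding_domRestrict_of_hasStrictFDerivAt hU hinj
      (fun z hz => (hf z hz).hasStrictFDerivAt) fun z hz => ?_).isEmbedding
    exact LinearMap.injective_iff_surjective.1 <| (hf z hz).injective_fderiv
      (fun w => by simp [omega]) fun v => eq_zero_of_omega_eq_zero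
  mapsTo := hmaps
  pullback_omega z hz := (hf z hz).form_fderiv

/-- The map which applies `Φ` to the pair of coordinates `i` and `j`, and fixes the others. -/
def mapPair (i j : Fin n) (Φ : ℂ × ℂ → ℂ × ℂ) (z : Fin n → ℂ) : Fin n → ℂ :=
  fun k => if k = i then (Φ (z i, z j)).1 else if k = j then (Φ (z i, z j)).2 else z k

variable {i j : Fin n} {Φ : ℂ × ℂ → ℂ × ℂ}

theorem mapPair_left (z : Fin n → ℂ) : mapPair i j Φ z i = (Φ (z i, z j)).1 := if_pos rfl

theorem mapPair_right (hij : i ≠ j) (z : Fin n → ℂ) : mapPair i j Φ z j = (Φ (z i, z j)).2 := by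
  rw [mapPair, if_neg hij.symm, if_pos rfl]

theorem mapPair_of_ne {k : Fin n} (hki : k ≠ i) (hkj : k ≠ j) (z : Fin n → ℂ) :
    mapPair i j Φ z k = z k := by
  rw [mapPair, if_neg hki, if_neg hkj]

theorem sum_eq_add_add_sum_erase {ι M : Type*} [Fintype ι] [DecidableEq ι] [AddCommMonoid M]
    {i j : ι} (hij : i ≠ j) (f : ι → M) :
    ∑ k, f k = f i + f j + ∑ k ∈ (Finset.univ.erase i).erase j, f k := by
  rw [← Finset.add_sum_erase _ _ (Finset.mem_univ i),
    ← Finset.add_sum_erase _ _ (Finset.mem_erase.2 ⟨hij.symm, Finset.mem_univ j⟩), add_assoc]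

theorem contDiffAt_mapPair {z : Fin n → ℂ} (h : ContDiffAt ℝ ∞ Φ (z i, z j)) :
    ContDiffAt ℝ ∞ (mapPair i j Φ) z := by
  have hΦ : ContDiffAt ℝ ∞ (fun x : Fin n → ℂ => Φ (x i, x j)) z :=
    h.comp z ((contDiffAt_apply ..).prodMk (contDiffAt_apply ..))
  refine contDiffAt_pi.2 fun k => ?_
  unfold mapPair
  split_ifs
  exacts [contDiffAt_fst.comp z hΦ, contDiffAt_snd.comp z hΦ, contDiffAt_apply ..]

theorem hasFDerivAt_mapPair {z : Fin n → ℂ} {D : ℂ × ℂ →L[ℝ] ℂ × ℂ}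
    (h : HasFDerivAt Φ D (z i, z j)) : ∃ L : (Fin n → ℂ) →L[ℝ] (Fin n → ℂ),
      HasFDerivAt (mapPair i j Φ) L z ∧ ∀ v, L v = mapPair i j D v := by
  let pair : (Fin n → ℂ) →L[ℝ] ℂ × ℂ :=
    (ContinuousLinearMap.proj i).prod (ContinuousLinearMap.proj j)
  have hΦ : HasFDerivAt (fun x : Fin n → ℂ => Φ (x i, x j)) (D.comp pair) z :=
    HasFDerivAt.comp (f := pair) z h pair.hasFDerivAt
  refine ⟨.pi fun k => if k = i then (ContinuousLinearMap.fst ℝ ℂ ℂ).comp (D.comp pair)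
    else if k = j then (ContinuousLinearMap.snd ℝ ℂ ℂ).comp (D.comp pair)
    else ContinuousLinearMap.proj k, hasFDerivAt_pi.2 fun k => ?_, fun v => funext fun k => ?_⟩
  · unfold mapPair
    split_ifs
    exacts [hasFDerivAt_fst.comp z hΦ, hasFDerivAt_snd.comp z hΦ, hasFDerivAt_apply ..]
  · simp only [mapPair, ContinuousLinearMap.pi_apply]
    split_ifs <;> rfl

theorem PullsBackAt.mapPair (hij : i ≠ j) {z : Fin n → ℂ}
    (h : PullsBackAt Φ prodForm prodForm (z i, z j)) :
    PullsBackAt (mapPair i j Φ) omega omega z := by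
  obtain ⟨L, hL, hLv⟩ := hasFDerivAt_mapPair h.hasFDerivAt
  refine .of_hasFDerivAt (contDiffAt_mapPair h.contDiffAt) hL fun v w => ?_
  rw [omega, omega, sum_eq_add_add_sum_erase hij, sum_eq_add_add_sum_erase hij, hLv, hLv]
  refine congrArg₂ (· + ·) ?_ (Finset.sum_congr rfl fun k hk => ?_)
  · simp only [mapPair_left, mapPair_right hij]
    exact h.form_fderiv (v i, v j) (w i, w j)
  · obtain ⟨hkj, hki, -⟩ := by simpa only [Finset.mem_erase] using hk
    simp only [mapPair_of_ne hki hkj]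

theorem injOn_mapPair (hij : i ≠ j) {D : Set (ℂ × ℂ)} (hΦ : D.InjOn Φ) :
    {z : Fin n → ℂ | (z i, z j) ∈ D}.InjOn (mapPair i j Φ) := by
  intro z hz z' hz' h
  have hpair : (z i, z j) = (z' i, z' j) := by
    refine hΦ hz hz' (Prod.ext ?_ ?_)
    · simpa only [mapPair_left] using congrFun h i
    · simpa only [mapPair_right hij] using congrFun h j
  funext k
  by_cases hki : k = i
  · rw [hki]
    exact congrArg Prod.fst hpair
  by_cases hkj : k = j
  · rw [hkj]
    exact congrArg Prod.snd hpair
  · simpa only [mapPair_of_ne hki hkj] using congrFun h k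

end Embedding

/-! ### Area preserving maps from generating functions -/

section GeneratingFunction

/-- With `X = ∂S/∂Y` and `y = ∂S/∂x`, the generating function `S(x, Y) = xY - k(x) Q(Y)` defines the
area preserving map `(x, y) ↦ (X, Y)`. This is the map `(x, Y) ↦ (x, y)`. -/
noncomputable def genSource (k Q : ℝ → ℝ) (p : ℂ) : ℂ := ⟨p.re, p.im - deriv k p.re * Q p.im⟩

/-- The map `(x, Y) ↦ (X, Y)` for the generating function `S(x, Y) = xY - k(x) Q(Y)`;
see `genSource`. -/
noncomputable def genTarget (k Q : ℝ → ℝ) (p : ℂ) : ℂ := ⟨p.re - deriv Q p.im * k p.re, p.im⟩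

variable {k Q : ℝ → ℝ}

theorem hasDerivAt_deriv {f : ℝ → ℝ} (hf : ContDiff ℝ ∞ f) (x : ℝ) :
    HasDerivAt f (deriv f x) x :=
  (hf.differentiable (by simp) x).hasDerivAt

theorem contDiff_deriv {f : ℝ → ℝ} (hf : ContDiff ℝ ∞ f) : ContDiff ℝ ∞ (deriv f) :=
  (contDiff_infty_iff_deriv.1 hf).2

theorem pullsBackAt_genSource (hk : ContDiff ℝ ∞ k) (hQ : ContDiff ℝ ∞ Q) (p : ℂ) :
    PullsBackAt (genSource k Q) areaForm
      (fun v w => (1 - deriv k p.re * deriv Q p.im) * areaForm v w) p := by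
  have hk' := contDiff_deriv hk
  refine pullsBackAt_complex_mk (by fun_prop) (by fun_prop) (hasFDerivAt_re p)
    ((hasFDerivAt_im p).sub
      (((hasDerivAt_deriv hk' p.re).comp_hasFDerivAt p (hasFDerivAt_re p)).mul
        ((hasDerivAt_deriv hQ p.im).comp_hasFDerivAt p (hasFDerivAt_im p)))) fun v w => ?_
  simp only [Complex.reCLM_apply, Function.comp_apply, sub_apply, Complex.imCLM_apply, add_apply,
    smul_apply, smul_eq_mul, areaForm]
  ring

theorem pullsBackAt_genTarget (hk : ContDiff ℝ ∞ k) (hQ : ContDiff ℝ ∞ Q) (p : ℂ) :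
    PullsBackAt (genTarget k Q) areaForm
      (fun v w => (1 - deriv k p.re * deriv Q p.im) * areaForm v w) p := by
  have hQ' := contDiff_deriv hQ
  refine pullsBackAt_complex_mk (by fun_prop) (by fun_prop)
    ((hasFDerivAt_re p).sub
      (((hasDerivAt_deriv hQ' p.im).comp_hasFDerivAt p (hasFDerivAt_im p)).mul
        ((hasDerivAt_deriv hk p.re).comp_hasFDerivAt p (hasFDerivAt_re p))))
    (hasFDerivAt_im p) fun v w => ?_
  simp only [Function.comp_apply, sub_apply, Complex.reCLM_apply, add_apply, smul_apply,
    smul_eq_mul, Complex.imCLM_apply, areaForm]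
  ring

theorem injective_genSource (hQ : ContDiff ℝ ∞ Q)
    (hpos : ∀ x y, 0 < 1 - deriv k x * deriv Q y) : Function.Injective (genSource k Q) := by
  intro p p' h
  obtain ⟨hre, him⟩ := Complex.ext_iff.1 h
  have hmono : StrictMono fun y => y - deriv k p.re * Q y :=
    strictMono_of_hasDerivAt_pos
      (fun y => (hasDerivAt_id y).sub ((hasDerivAt_deriv hQ y).const_mul _)) (hpos p.re)
  simp only [genSource] at hre him
  exact Complex.ext hre (hmono.injective (by simpa only [hre] using him))

theorem injective_genTarget (hk : ContDiff ℝ ∞ k)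
    (hpos : ∀ x y, 0 < 1 - deriv k x * deriv Q y) : Function.Injective (genTarget k Q) := by
  intro p p' h
  obtain ⟨hre, him⟩ := Complex.ext_iff.1 h
  have hmono : StrictMono fun x => x - deriv Q p.im * k x :=
    strictMono_of_hasDerivAt_pos
      (fun x => (hasDerivAt_id x).sub ((hasDerivAt_deriv hk x).const_mul _))
      fun x => by simpa only [mul_comm] using hpos x p.im
  simp only [genTarget] at hre him
  exact Complex.ext (hmono.injective (by simpa only [him] using hre)) him

theorem surjective_genSource (hsurj : ∀ x, Function.Surjective fun y => y - deriv k x * Q y) :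
    Function.Surjective (genSource k Q) := fun z =>
  let ⟨Y, hY⟩ := hsurj z.re z.im
  ⟨⟨z.re, Y⟩, Complex.ext rfl hY⟩

theorem exists_areaPreserving_of_generatingFunction (hk : ContDiff ℝ ∞ k) (hQ : ContDiff ℝ ∞ Q)
    (hpos : ∀ x y, 0 < 1 - deriv k x * deriv Q y)
    (hsurj : ∀ x, Function.Surjective fun y => y - deriv k x * Q y) :
    ∃ τ : ℂ → ℂ, (∀ z, PullsBackAt τ areaForm areaForm z) ∧ Function.Injective τ ∧
      ∀ z, ∃ Y, z.im = Y - deriv k z.re * Q Y ∧ τ z = ⟨z.re - deriv Q Y * k z.re, Y⟩ := by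
  obtain ⟨G, hG⟩ := (surjective_genSource hsurj).hasRightInverse
  have hsource := fun z => pullsBackAt_genSource hk hQ (G z)
  have hGsmooth : ∀ z, ContDiffAt ℝ ∞ G z := fun z =>
    contDiffAt_of_rightInverse (injective_genSource hQ hpos) hG (hsource z).contDiffAt
      ((hsource z).injective_fderiv areaForm_zero_left fun v hv =>
        eq_zero_of_areaForm_eq_zero fun w => (mul_eq_zero.1 (hv w)).resolve_left (hpos _ _).ne')
  refine ⟨genTarget k Q ∘ G, fun z => ?_, (injective_genTarget hk hpos).comp hG.injective,
    fun z => ?_⟩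
  · exact (pullsBackAt_genTarget hk hQ (G z)).comp
      ((hsource z).of_eventually_rightInverse (hGsmooth z) (.of_forall hG))
  · obtain ⟨hre, him⟩ := Complex.ext_iff.1 (hG z)
    simp only [genSource] at hre him
    exact ⟨(G z).im, by rw [← him, hre], by simp only [Function.comp_apply, genTarget, hre]⟩

end GeneratingFunction

section SlitEmbedding

/-- A smooth approximation from above of the positive part of `x`, equal to it for `d = 0`. -/
noncomputable def smoothPosPart (d x : ℝ) : ℝ := (x + √(x ^ 2 + d ^ 2)) / 2

/-- A bounded smooth function of slope `1` at `0`, of size proportional to `d`. -/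
noncomputable def scaledArctan (d y : ℝ) : ℝ := d * Real.arctan (y / d)

variable {d : ℝ}

theorem abs_lt_sqrt_sq_add_sq (hd : 0 < d) (x : ℝ) : |x| < √(x ^ 2 + d ^ 2) :=
  Real.lt_sqrt_of_sq_lt (by rw [sq_abs]; linarith [pow_pos hd 2])

theorem contDiff_smoothPosPart (hd : 0 < d) : ContDiff ℝ ∞ (smoothPosPart d) :=
  (contDiff_id.add (ContDiff.sqrt (by fun_prop) fun x => by positivity)).div_const 2

theorem deriv_smoothPosPart (hd : 0 < d) (x : ℝ) :
    deriv (smoothPosPart d) x = (1 + x / √(x ^ 2 + d ^ 2)) / 2 := by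
  have hsq : HasDerivAt (fun x : ℝ => x ^ 2 + d ^ 2) (2 * x) x := by
    simpa using (hasDerivAt_pow 2 x).add_const (d ^ 2)
  rw [HasDerivAt.deriv (f := smoothPosPart d)
      (((hasDerivAt_id x).add (hsq.sqrt (by positivity))).div_const 2),
    mul_div_mul_left _ _ two_ne_zero]

theorem deriv_smoothPosPart_mem_Ioo (hd : 0 < d) (x : ℝ) :
    deriv (smoothPosPart d) x ∈ Set.Ioo 0 1 := by
  obtain ⟨hlt, hgt⟩ := abs_lt.1 (abs_lt_sqrt_sq_add_sq hd x)
  have hroot : 0 < √(x ^ 2 + d ^ 2) := by positivity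
  have hlower : -1 < x / √(x ^ 2 + d ^ 2) := by rw [lt_div_iff₀ hroot]; linarith
  have hupper : x / √(x ^ 2 + d ^ 2) < 1 := by rwa [div_lt_one hroot]
  rw [deriv_smoothPosPart hd]
  constructor <;> linarith

theorem smoothPosPart_pos (hd : 0 < d) (x : ℝ) : 0 < smoothPosPart d x := by
  have := (abs_lt.1 (abs_lt_sqrt_sq_add_sq hd x)).1
  rw [smoothPosPart]
  linarith

theorem lt_smoothPosPart (hd : 0 < d) (x : ℝ) : x < smoothPosPart d x := by
  have := (abs_lt.1 (abs_lt_sqrt_sq_add_sq hd x)).2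
  rw [smoothPosPart]
  linarith

theorem smoothPosPart_le (hd : 0 < d) (x : ℝ) : smoothPosPart d x ≤ (x + |x| + d) / 2 := by
  have : √(x ^ 2 + d ^ 2) ≤ |x| + d := by
    rw [Real.sqrt_le_left (by positivity)]
    nlinarith [sq_abs x, abs_nonneg x]
  rw [smoothPosPart]
  linarith

theorem contDiff_scaledArctan : ContDiff ℝ ∞ (scaledArctan d) :=
  contDiff_const.mul (Real.contDiff_arctan.comp (contDiff_id.div_const d))

theorem deriv_scaledArctan (hd : 0 < d) (y : ℝ) :
    deriv (scaledArctan d) y = 1 / (1 + (y / d) ^ 2) := by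
  rw [HasDerivAt.deriv (f := scaledArctan d) ((((hasDerivAt_id y).div_const d).arctan).const_mul d)]
  simp only [id]
  field_simp

theorem deriv_scaledArctan_mem_Ioc (hd : 0 < d) (y : ℝ) :
    deriv (scaledArctan d) y ∈ Set.Ioc 0 1 := by
  rw [deriv_scaledArctan hd]
  exact ⟨by positivity, div_le_one_of_le₀ (by linarith [sq_nonneg (y / d)]) (by positivity)⟩

theorem abs_scaledArctan_le (hd : 0 < d) (y : ℝ) : |scaledArctan d y| ≤ 2 * d := by
  have harctan : |Real.arctan (y / d)| ≤ 2 := by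
    have := Real.pi_lt_four
    rw [abs_le]
    constructor <;>
      linarith [Real.neg_pi_div_two_lt_arctan (y / d), Real.arctan_lt_pi_div_two (y / d)]
  rw [scaledArctan, abs_mul, abs_of_pos hd, mul_comm]
  gcongr

theorem abs_deriv_smoothPosPart_mul_scaledArctan_le (hd : 0 < d) (x y : ℝ) :
    |deriv (smoothPosPart d) x * scaledArctan d y| ≤ 2 * d := by
  obtain ⟨hpos, hlt⟩ := deriv_smoothPosPart_mem_Ioo hd x
  rw [abs_mul, abs_of_pos hpos]
  exact (mul_le_of_le_one_left (abs_nonneg _) hlt.le).trans (abs_scaledArctan_le hd y)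

theorem surjective_sub_of_abs_le {g : ℝ → ℝ} {B : ℝ} (hg : Continuous g) (hB : ∀ y, |g y| ≤ B) :
    Function.Surjective fun y => y - g y := by
  refine (continuous_id.sub hg).surjective ?_ ?_
  · exact tendsto_atTop_mono (fun y => sub_le_sub_left (abs_le.1 (hB y)).2 y)
      (tendsto_atTop_add_const_right _ (-B) tendsto_id)
  · exact tendsto_atBot_mono (fun y => sub_le_sub_left (abs_le.1 (hB y)).1 y)
      (tendsto_atBot_add_const_right _ (-(-B)) tendsto_id)

theorem exists_slit_embedding (hd : 0 < d) :
    ∃ τ : ℂ → ℂ, (∀ z, PullsBackAt τ areaForm areaForm z) ∧ Function.Injective τ ∧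
      ∀ z, -τ z ∈ Complex.slitPlane ∧ |(τ z).re| ≤ |z.re| + d ∧ |(τ z).im| ≤ |z.im| + 2 * d := by
  have hbound := abs_deriv_smoothPosPart_mul_scaledArctan_le hd
  obtain ⟨τ, hτ, hinj, hform⟩ := exists_areaPreserving_of_generatingFunction
    (contDiff_smoothPosPart hd) (contDiff_scaledArctan (d := d))
    (fun x y => sub_pos.2 <| mul_lt_one_of_nonneg_of_lt_one_left
      (deriv_smoothPosPart_mem_Ioo hd x).1.le (deriv_smoothPosPart_mem_Ioo hd x).2
      (deriv_scaledArctan_mem_Ioc hd y).2)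
    fun x => surjective_sub_of_abs_le (contDiff_scaledArctan.continuous.const_mul _) (hbound x)
  refine ⟨τ, hτ, hinj, fun z => ?_⟩
  obtain ⟨Y, hY, hz⟩ := hform z
  obtain ⟨hslope_pos, hslope_le⟩ := deriv_scaledArctan_mem_Ioc hd Y
  rw [hz]
  refine ⟨?_, ?_, ?_⟩
  · rcases eq_or_ne Y 0 with rfl | hY0
    · refine .inl ?_
      have := lt_smoothPosPart hd z.re
      simpa [deriv_scaledArctan hd] using this
    · exact .inr (neg_ne_zero.2 hY0)
  · have hlower := mul_pos hslope_pos (smoothPosPart_pos hd z.re)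
    have hupper := mul_le_of_le_one_left (smoothPosPart_pos hd z.re).le hslope_le
    have := smoothPosPart_le hd z.re
    exact abs_le.2 ⟨by linarith [neg_abs_le z.re], by linarith [le_abs_self z.re]⟩
  · calc |Y| = |z.im + deriv (smoothPosPart d) z.re * scaledArctan d Y| := by rw [hY]; ring_nf
      _ ≤ |z.im| + 2 * d := (abs_add_le _ _).trans (by gcongr; exact hbound z.re Y)

end SlitEmbedding

/-! ### Symplectic polar coordinates -/

section Polar

/-- Symplectic polar coordinates `(π r², θ / 2π)` on the complement of the ray `[0, ∞)`. The angle
is `π` plus the argument of `-w`, whose branch cut is this ray. -/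
noncomputable def toPolar (w : ℂ) : ℂ :=
  ⟨Real.pi * ‖w‖ ^ 2, Complex.arg (-w) / (2 * Real.pi) + 1 / 2⟩

/-- The inverse of symplectic polar coordinates, defined and periodic in the second coordinate on
the whole half plane `0 < p.re`. -/
noncomputable def ofPolar (p : ℂ) : ℂ :=
  ⟨√(p.re / Real.pi) * Real.cos (2 * Real.pi * p.im),
    √(p.re / Real.pi) * Real.sin (2 * Real.pi * p.im)⟩

theorem pullsBackAt_ofPolar {p : ℂ} (hp : 0 < p.re) : PullsBackAt ofPolar areaForm areaForm p := by
  have hp' : p.re / Real.pi ≠ 0 := (div_pos hp Real.pi_pos).ne'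
  have hroot : HasFDerivAt (fun p : ℂ => √(p.re / Real.pi)) _ p :=
    ((hasFDerivAt_re p).mul_const Real.pi⁻¹).sqrt hp'
  have hangle := (hasFDerivAt_im p).const_mul (2 * Real.pi)
  refine pullsBackAt_complex_mk (by fun_prop (disch := exact hp'))
    (by fun_prop (disch := exact hp')) (hroot.mul hangle.cos) (hroot.mul hangle.sin) fun v w => ?_
  have hcs := Real.sin_sq_add_cos_sq (2 * Real.pi * p.im)
  have hr := Real.sqrt_pos.2 (div_pos hp Real.pi_pos)
  simp only [← div_eq_mul_inv]
  set c := Real.cos (2 * Real.pi * p.im)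
  set s := Real.sin (2 * Real.pi * p.im)
  set r := √(p.re / Real.pi)
  simp only [one_div, mul_inv_rev, add_apply, smul_apply, Complex.imCLM_apply, smul_eq_mul,
    neg_mul, mul_neg, Complex.reCLM_apply, areaForm]
  field_simp
  linear_combination 4 * r ^ 2 * Real.pi ^ 2 * (v.re * w.im - v.im * w.re) * hcs

theorem pi_mul_norm_ofPolar_sq {p : ℂ} (hp : 0 ≤ p.re) : Real.pi * ‖ofPolar p‖ ^ 2 = p.re := by
  have hroot : √(p.re / Real.pi) ^ 2 = p.re / Real.pi := Real.sq_sqrt (by positivity)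
  have hcs := Real.sin_sq_add_cos_sq (2 * Real.pi * p.im)
  rw [Complex.sq_norm, Complex.normSq_apply, ofPolar]
  calc _ = Real.pi * √(p.re / Real.pi) ^ 2 := by
        linear_combination Real.pi * √(p.re / Real.pi) ^ 2 * hcs
    _ = p.re := by rw [hroot]; field_simp

theorem ofPolar_eq_mul_exp (p : ℂ) :
    ofPolar p = (√(p.re / Real.pi) : ℂ) * Complex.exp (2 * Real.pi * p.im * Complex.I) := by
  have hangle : 2 * (Real.pi : ℂ) * p.im * Complex.I
      = ((2 * Real.pi * p.im : ℝ) : ℂ) * Complex.I := by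
    push_cast
    rfl
  rw [hangle]
  apply Complex.ext
  · rw [Complex.re_ofReal_mul, Complex.exp_ofReal_mul_I_re, ofPolar]
  · rw [Complex.im_ofReal_mul, Complex.exp_ofReal_mul_I_im, ofPolar]

theorem re_eq_and_exists_im_eq_of_ofPolar_eq {p p' : ℂ} (hp : 0 < p.re) (hp' : 0 < p'.re)
    (h : ofPolar p = ofPolar p') : p.re = p'.re ∧ ∃ m : ℤ, p.im = p'.im + m := by
  have hre : p.re = p'.re := by
    rw [← pi_mul_norm_ofPolar_sq hp.le, h, pi_mul_norm_ofPolar_sq hp'.le]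
  refine ⟨hre, ?_⟩
  have hroot : ((√(p'.re / Real.pi) : ℝ) : ℂ) ≠ 0 :=
    mod_cast (Real.sqrt_pos.2 (div_pos hp' Real.pi_pos)).ne'
  rw [ofPolar_eq_mul_exp, ofPolar_eq_mul_exp, hre] at h
  obtain ⟨m, hm⟩ := Complex.exp_eq_exp_iff_exists_int.1 (mul_left_cancel₀ hroot h)
  have him : 2 * (Real.pi : ℂ) * Complex.I * p.im = 2 * Real.pi * Complex.I * (p'.im + m) := by
    linear_combination hm
  have him' := mul_left_cancel₀ Complex.two_pi_I_ne_zero him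
  exact ⟨m, mod_cast him'⟩

theorem injOn_ofPolar : {p : ℂ | 0 < p.re ∧ 0 < p.im ∧ p.im < 1}.InjOn ofPolar := by
  rintro p ⟨hp, hlower, hupper⟩ p' ⟨hp', hlower', hupper'⟩ h
  obtain ⟨hre, m, hm⟩ := re_eq_and_exists_im_eq_of_ofPolar_eq hp hp' h
  have hm_lt : (m : ℝ) < 1 := by linarith
  have hm_gt : (-1 : ℝ) < m := by linarith
  obtain rfl : m = 0 := by
    norm_cast at hm_lt hm_gt
    omega
  exact Complex.ext hre (by simpa using hm)

theorem toPolar_re_pos {w : ℂ} (hw : -w ∈ Complex.slitPlane) : 0 < (toPolar w).re :=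
  mul_pos Real.pi_pos (pow_pos (norm_pos_iff.2 (neg_ne_zero.1 (Complex.slitPlane_ne_zero hw))) 2)

theorem toPolar_im_mem_Ioo {w : ℂ} (hw : -w ∈ Complex.slitPlane) :
    (toPolar w).im ∈ Set.Ioo 0 1 := by
  have hlower := Complex.neg_pi_lt_arg (-w)
  have hupper : (-w).arg < Real.pi :=
    lt_of_le_of_ne (Complex.arg_le_pi _) (Complex.mem_slitPlane_iff_arg.1 hw).1
  have hscaled_lower : -1 / 2 < (-w).arg / (2 * Real.pi) := by
    rw [lt_div_iff₀ (by positivity)]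
    linarith
  have hscaled_upper : (-w).arg / (2 * Real.pi) < 1 / 2 := by
    rw [div_lt_iff₀ (by positivity)]
    linarith
  exact ⟨by rw [toPolar]; linarith, by rw [toPolar]; linarith⟩

theorem ofPolar_toPolar (w : ℂ) : ofPolar (toPolar w) = w := by
  have hpi : (Real.pi : ℂ) ≠ 0 := mod_cast Real.pi_ne_zero
  have hroot : √(Real.pi * ‖w‖ ^ 2 / Real.pi) = ‖-w‖ := by
    rw [mul_div_cancel_left₀ _ Real.pi_ne_zero, Real.sqrt_sq (norm_nonneg w), norm_neg]
  have hangle : 2 * (Real.pi : ℂ) * (((-w).arg / (2 * Real.pi) + 1 / 2 : ℝ) : ℂ) * Complex.I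
      = (-w).arg * Complex.I + Real.pi * Complex.I := by
    push_cast
    field_simp
  simp only [ofPolar_eq_mul_exp, toPolar]
  rw [hroot, hangle, Complex.exp_add, Complex.exp_pi_mul_I, ← mul_assoc,
    Complex.norm_mul_exp_arg_mul_I, mul_neg_one, neg_neg]

theorem contDiffAt_toPolar {w : ℂ} (hw : -w ∈ Complex.slitPlane) : ContDiffAt ℝ ∞ toPolar w := by
  have hlog : ContDiffAt ℝ ∞ (fun w => Complex.log (-w)) w :=
    ((Complex.contDiffAt_log hw).restrict_scalars ℝ).comp w contDiff_neg.contDiffAt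
  have harg : ContDiffAt ℝ ∞ (fun w => Complex.arg (-w)) w :=
    (contDiff_im.contDiffAt.comp w hlog).congr_of_eventuallyEq
      (.of_forall fun x => (Complex.log_im (-x)).symm)
  exact contDiffAt_complex_mk (contDiffAt_const.mul (contDiff_norm_sq ℝ).contDiffAt)
    ((harg.div_const _).add contDiffAt_const)

theorem pullsBackAt_toPolar {w : ℂ} (hw : -w ∈ Complex.slitPlane) :
    PullsBackAt toPolar areaForm areaForm w :=
  (pullsBackAt_ofPolar (toPolar_re_pos hw)).of_eventually_rightInverse (contDiffAt_toPolar hw)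
    (.of_forall ofPolar_toPolar)

end Polar

section StripCoordinate

theorem norm_sq_le_of_abs_le {R d : ℝ} {z w : ℂ} (hd : 0 ≤ d) (hd1 : d ≤ 1) (hz : ‖z‖ ≤ R)
    (hre : |w.re| ≤ |z.re| + d) (him : |w.im| ≤ |z.im| + 2 * d) :
    ‖w‖ ^ 2 ≤ ‖z‖ ^ 2 + (6 * R + 5) * d := by
  have hzre : |z.re| ≤ R := (Complex.abs_re_le_norm z).trans hz
  have hzim : |z.im| ≤ R := (Complex.abs_im_le_norm z).trans hz
  calc ‖w‖ ^ 2 = |w.re| ^ 2 + |w.im| ^ 2 := by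
        rw [Complex.sq_norm, Complex.normSq_apply, sq_abs, sq_abs, sq, sq]
    _ ≤ (|z.re| + d) ^ 2 + (|z.im| + 2 * d) ^ 2 := by gcongr
    _ = |z.re| ^ 2 + |z.im| ^ 2 + (2 * |z.re| + 4 * |z.im| + 5 * d) * d := by ring
    _ ≤ |z.re| ^ 2 + |z.im| ^ 2 + (6 * R + 5) * d := by gcongr <;> linarith
    _ = ‖z‖ ^ 2 + (6 * R + 5) * d := by
        rw [Complex.sq_norm, Complex.normSq_apply, sq_abs, sq_abs, sq, sq]

theorem exists_strip_coordinate {R e : ℝ} (hR : 0 ≤ R) (he : 0 < e) :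
    ∃ P : ℂ → ℂ, (∀ z, PullsBackAt P areaForm areaForm z) ∧ Function.Injective P ∧
      ∀ z, 0 < (P z).re ∧ (P z).im ∈ Set.Ioo 0 1 ∧
        (‖z‖ ≤ R → (P z).re ≤ Real.pi * ‖z‖ ^ 2 + e) := by
  obtain ⟨d, hd, hd1, hde⟩ : ∃ d : ℝ, 0 < d ∧ d ≤ 1 ∧ Real.pi * ((6 * R + 5) * d) ≤ e := by
    refine ⟨min 1 (e / (Real.pi * (6 * R + 5))), by positivity, min_le_left _ _, ?_⟩
    rw [← mul_assoc, ← le_div_iff₀' (by positivity)]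
    exact min_le_right _ _
  obtain ⟨τ, hτ, hinj, hslit⟩ := exists_slit_embedding hd
  refine ⟨toPolar ∘ τ, fun z => (pullsBackAt_toPolar (hslit z).1).comp (hτ z),
    (Function.LeftInverse.injective ofPolar_toPolar).comp hinj, fun z =>
      ⟨toPolar_re_pos (hslit z).1, toPolar_im_mem_Ioo (hslit z).1, fun hz => ?_⟩⟩
  obtain ⟨-, hre, him⟩ := hslit z
  calc Real.pi * ‖τ z‖ ^ 2 ≤ Real.pi * (‖z‖ ^ 2 + (6 * R + 5) * d) := by
        gcongr
        exact norm_sq_le_of_abs_le hd.le hd1 hz hre him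
    _ ≤ Real.pi * ‖z‖ ^ 2 + e := by rw [mul_add]; gcongr

end StripCoordinate

/-! ### Folding a half plane -/

section Fold

/-- The norm of `x + iκy`. -/
noncomputable def foldRadius (κ : ℝ) (p : ℂ) : ℝ := √(p.re ^ 2 + (κ * p.im) ^ 2)

/-- The area preserving fold of the upper half plane along the imaginary axis, which leaves room
`2κy` for the fold: the map `z ↦ -z² / |z|` in the coordinates `(x, κy)`, with the imaginary part
halved. For small `κ` it nearly maps `(x, y)` to `(-|x|, ∓y)`. -/
noncomputable def fold (κ : ℝ) (p : ℂ) : ℂ :=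
  ⟨-(p.re ^ 2 - (κ * p.im) ^ 2) / foldRadius κ p, -(p.re * p.im) / foldRadius κ p⟩

variable {κ : ℝ} {p : ℂ}

theorem foldRadius_sq : foldRadius κ p ^ 2 = p.re ^ 2 + (κ * p.im) ^ 2 :=
  Real.sq_sqrt (by positivity)

theorem foldRadius_pos (hκ : 0 < κ) (hp : 0 < p.im) : 0 < foldRadius κ p :=
  Real.sqrt_pos.2 (by positivity)

theorem abs_re_lt_foldRadius (hκ : 0 < κ) (hp : 0 < p.im) : |p.re| < foldRadius κ p :=
  Real.lt_sqrt_of_sq_lt (by rw [sq_abs]; linarith [pow_pos (mul_pos hκ hp) 2])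

theorem mul_im_le_foldRadius : κ * p.im ≤ foldRadius κ p :=
  Real.le_sqrt_of_sq_le (by linarith [sq_nonneg p.re])

theorem pullsBackAt_fold (hκ : 0 < κ) (hp : 0 < p.im) :
    PullsBackAt (fold κ) areaForm areaForm p := by
  have hne : p.re ^ 2 + (κ * p.im) ^ 2 ≠ 0 := by positivity
  have hr := foldRadius_pos hκ hp
  have hdim := (hasFDerivAt_im p).const_mul κ
  have hdinv := (hasDerivAt_inv hr.ne').comp_hasFDerivAt p
    ((((hasFDerivAt_re p).pow 2).add (hdim.pow 2)).sqrt hne)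
  have hsmooth : ContDiffAt ℝ ∞ (foldRadius κ) p := by
    unfold foldRadius
    fun_prop (disch := exact hne)
  refine pullsBackAt_complex_mk (.div (by fun_prop) hsmooth hr.ne')
    (.div (by fun_prop) hsmooth hr.ne')
    ((((hasFDerivAt_re p).pow 2).sub (hdim.pow 2)).neg.mul hdinv)
    (((hasFDerivAt_re p).mul (hasFDerivAt_im p)).neg.mul hdinv) fun v w => ?_
  have hsq : foldRadius κ p ^ 2 = p.re ^ 2 + (κ * p.im) ^ 2 := foldRadius_sq
  change 0 < √(p.re ^ 2 + (κ * p.im) ^ 2) at hr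
  simp only [foldRadius, Pi.add_apply] at hsq ⊢
  set r := √(p.re ^ 2 + (κ * p.im) ^ 2)
  simp only [Pi.neg_apply, Pi.sub_apply, neg_sub, one_div, mul_inv_rev, Nat.add_one_sub_one,
    pow_one, nsmul_eq_mul, Nat.cast_ofNat, smul_add, neg_smul, smul_neg, add_apply, neg_apply,
    smul_apply, Complex.reCLM_apply, smul_eq_mul, Complex.imCLM_apply, sub_apply, Pi.mul_apply,
    neg_neg, neg_add_rev, areaForm]
  field_simp
  simp only [show r ^ 6 = (r ^ 2) ^ 3 by ring, hsq]
  ring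

theorem neg_abs_le_re_fold (hκ : 0 < κ) (hp : 0 < p.im) : -|p.re| ≤ (fold κ p).re := by
  rw [fold, le_div_iff₀ (foldRadius_pos hκ hp)]
  nlinarith [abs_re_lt_foldRadius hκ hp, abs_nonneg p.re, sq_abs p.re, sq_nonneg (κ * p.im)]

theorem re_fold_le (hκ : 0 < κ) (hp : 0 < p.im) :
    (fold κ p).re ≤ -|p.re| + 2 * (κ * p.im) := by
  have hr := foldRadius_pos hκ hp
  have hsq : foldRadius κ p ^ 2 = p.re ^ 2 + (κ * p.im) ^ 2 := foldRadius_sq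
  calc (fold κ p).re = -foldRadius κ p + 2 * (κ * p.im * (κ * p.im)) / foldRadius κ p := by
        rw [fold]
        field_simp
        linarith
    _ ≤ -|p.re| + 2 * (κ * p.im * foldRadius κ p) / foldRadius κ p := by
        gcongr
        exacts [(abs_re_lt_foldRadius hκ hp).le, mul_im_le_foldRadius]
    _ = -|p.re| + 2 * (κ * p.im) := by field_simp

theorem abs_im_fold_lt (hκ : 0 < κ) (hp : 0 < p.im) : |(fold κ p).im| < p.im := by
  have hr := foldRadius_pos hκ hp
  rw [fold, abs_div, abs_neg, abs_mul, abs_of_pos hp, abs_of_pos hr, div_lt_iff₀ hr, mul_comm]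
  gcongr
  exact abs_re_lt_foldRadius hκ hp

theorem im_fold_neg_iff (hκ : 0 < κ) (hp : 0 < p.im) : (fold κ p).im < 0 ↔ 0 < p.re := by
  rw [fold, div_lt_iff₀ (foldRadius_pos hκ hp), zero_mul, neg_lt_zero,
    mul_pos_iff_of_pos_right hp]

theorem im_fold_pos_iff (hκ : 0 < κ) (hp : 0 < p.im) : 0 < (fold κ p).im ↔ p.re < 0 := by
  rw [fold, div_pos_iff_of_pos_right (foldRadius_pos hκ hp), ← neg_mul,
    mul_pos_iff_of_pos_right hp, neg_pos]

theorem foldRadius_sq_eq_of_fold (hκ : 0 < κ) (hp : 0 < p.im) :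
    foldRadius κ p ^ 2 = (fold κ p).re ^ 2 + 4 * κ ^ 2 * (fold κ p).im ^ 2 := by
  have hr := foldRadius_pos hκ hp
  simp only [fold]
  field_simp
  rw [show foldRadius κ p ^ 4 = (foldRadius κ p ^ 2) ^ 2 by ring, foldRadius_sq]
  ring

theorem injOn_fold (hκ : 0 < κ) : {p : ℂ | 0 < p.im}.InjOn (fold κ) := by
  intro p (hp : 0 < p.im) p' (hp' : 0 < p'.im) h
  have hr := foldRadius_pos hκ hp
  have hradius : foldRadius κ p = foldRadius κ p' := by
    rw [← sq_eq_sq₀ hr.le (foldRadius_pos hκ hp').le, foldRadius_sq_eq_of_fold hκ hp,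
      foldRadius_sq_eq_of_fold hκ hp', h]
  have hradius_sq : p.re ^ 2 + (κ * p.im) ^ 2 = p'.re ^ 2 + (κ * p'.im) ^ 2 := by
    rw [← foldRadius_sq, ← foldRadius_sq, hradius]
  obtain ⟨hre, him⟩ := Complex.ext_iff.1 h
  simp only [fold] at hre him
  rw [← hradius, div_left_inj' hr.ne'] at hre him
  have him_eq : p.im = p'.im := by
    refine mul_left_cancel₀ hκ.ne' ?_
    rw [← sq_eq_sq₀ (mul_pos hκ hp).le (mul_pos hκ hp').le]
    linarith
  rw [← him_eq, neg_inj] at him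
  exact Complex.ext (mul_right_cancel₀ hp.ne' him) him_eq

end Fold

/-! ### Shears and stretches -/

section Shear

/-- The shear `x₁ ↦ x₁ + C(x₂)`, completed to a symplectic map of `ℂ × ℂ`. -/
noncomputable def liftShear (C : ℝ → ℝ) (z : ℂ × ℂ) : ℂ × ℂ :=
  (⟨z.1.re + C z.2.re, z.1.im⟩, ⟨z.2.re, z.2.im - deriv C z.2.re * z.1.im⟩)

/-- The stretch `x ↦ f(x)`, completed to an area preserving map of `ℂ`. -/
noncomputable def stretch (f : ℝ → ℝ) (p : ℂ) : ℂ := ⟨f p.re, p.im / deriv f p.re⟩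

theorem pullsBackAt_liftShear {C : ℝ → ℝ} (hC : ContDiff ℝ ∞ C) (z : ℂ × ℂ) :
    PullsBackAt (liftShear C) prodForm prodForm z := by
  have hC' := contDiff_deriv hC
  have dre₁ := (hasFDerivAt_re z.1).comp z hasFDerivAt_fst
  have dim₁ := (hasFDerivAt_im z.1).comp z hasFDerivAt_fst
  have dre₂ := (hasFDerivAt_re z.2).comp z hasFDerivAt_snd
  have dim₂ := (hasFDerivAt_im z.2).comp z hasFDerivAt_snd
  have dC := (hasDerivAt_deriv hC z.2.re).comp_hasFDerivAt z dre₂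
  have dC' := (hasDerivAt_deriv hC' z.2.re).comp_hasFDerivAt z dre₂
  refine .of_hasFDerivAt ((contDiffAt_complex_mk (by fun_prop) (by fun_prop)).prodMk
      (contDiffAt_complex_mk (by fun_prop) (by fun_prop)))
    ((hasFDerivAt_complex_mk (dre₁.add dC) dim₁).prodMk
      (hasFDerivAt_complex_mk dre₂ (dim₂.sub (dC'.mul dim₁)))) fun v w => ?_
  simp only [prodForm, areaForm, Function.comp_apply, ContinuousLinearMap.prod_apply,
    ContinuousLinearMap.comp_apply, add_apply, ContinuousLinearMap.coe_fst', Complex.reCLM_apply,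
    smul_apply, ContinuousLinearMap.coe_snd', smul_eq_mul, Complex.imCLM_apply,
    ContinuousLinearEquiv.coe_coe, sub_apply, Complex.equivRealProdCLM_symm_apply_re,
    Complex.equivRealProdCLM_symm_apply_im]
  ring

theorem pullsBackAt_stretch {f : ℝ → ℝ} (hf : ContDiff ℝ ∞ f) {p : ℂ} (hp : 0 < deriv f p.re) :
    PullsBackAt (stretch f) areaForm areaForm p := by
  have hf' := contDiff_deriv hf
  have df := (hasDerivAt_deriv hf p.re).comp_hasFDerivAt p (hasFDerivAt_re p)
  have df' := (hasDerivAt_deriv hf' p.re).comp_hasFDerivAt p (hasFDerivAt_re p)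
  refine pullsBackAt_complex_mk (by fun_prop) (.div (by fun_prop) (by fun_prop) hp.ne') df
    ((hasFDerivAt_im p).mul ((hasDerivAt_inv hp.ne').comp_hasFDerivAt p df')) fun v w => ?_
  simp only [smul_apply, Complex.reCLM_apply, smul_eq_mul, neg_smul, smul_neg, add_apply,
    neg_apply, Complex.imCLM_apply, areaForm]
  field_simp
  ring

end Shear

/-! ### The folding profile -/

section Profile

theorem exists_smooth_step {h p s : ℝ} (hh : 0 ≤ h) (hps : p < s) :
    ∃ C : ℝ → ℝ, ContDiff ℝ ∞ C ∧ Antitone C ∧ (∀ u, C u ∈ Set.Icc 0 h) ∧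
      (∀ u ≤ p, C u = h) ∧ ∀ u, s ≤ u → C u = 0 := by
  have hd : 0 < s - p := sub_pos.2 hps
  refine ⟨fun u => h * Real.smoothTransition ((s - u) / (s - p)), ?_, fun x y hxy => ?_,
    fun u => ⟨?_, ?_⟩, fun u hu => ?_, fun u hu => ?_⟩
  · exact contDiff_const.mul (Real.smoothTransition.contDiff.comp (by fun_prop))
  · dsimp only
    gcongr
    exact Real.smoothTransition.monotone (by gcongr)
  · exact mul_nonneg hh (Real.smoothTransition.nonneg _)
  · exact mul_le_of_le_one_right hh (Real.smoothTransition.le_one _)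
  · dsimp only
    rw [Real.smoothTransition.one_of_one_le ((one_le_div hd).2 (by linarith)), mul_one]
  · dsimp only
    rw [Real.smoothTransition.zero_of_nonpos
      (div_nonpos_of_nonpos_of_nonneg (by linarith) hd.le), mul_zero]

theorem exists_smooth_plateau {p s r t : ℝ} (hps : p < s) (hrt : r < t) :
    ∃ β : ℝ → ℝ, ContDiff ℝ ∞ β ∧ (∀ u, β u ∈ Set.Icc 0 1) ∧ (∀ u ≤ p, β u = 0) ∧
      (∀ u ∈ Set.Icc s r, β u = 1) ∧ ∀ u, t ≤ u → β u = 0 := by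
  obtain ⟨A, hA, -, hA01, hAp, hAs⟩ := exists_smooth_step zero_le_one hps
  obtain ⟨A', hA', -, hA'01, hAr, hAt⟩ := exists_smooth_step zero_le_one hrt
  refine ⟨fun u => (1 - A u) * A' u, (contDiff_const.sub hA).mul hA', fun u => ⟨?_, ?_⟩,
    fun u hu => by simp [hAp u hu], fun u hu => by simp [hAs u hu.1, hAr u hu.2],
    fun u hu => by simp [hAt u hu]⟩
  · exact mul_nonneg (sub_nonneg.2 (hA01 u).2) (hA'01 u).1
  · exact mul_le_one₀ (sub_le_self _ (hA01 u).1) (hA'01 u).1 (hA'01 u).2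

theorem exists_contDiff_deriv_eq {β : ℝ → ℝ} (hβ : ContDiff ℝ ∞ β) :
    ∃ B : ℝ → ℝ, ContDiff ℝ ∞ B ∧ deriv B = β := by
  have hB : ∀ u, HasDerivAt (fun u => ∫ x in 0..u, β x) (β u) u := fun u =>
    (hβ.continuous.integral_hasStrictDerivAt 0 u).hasDerivAt
  have hderiv := funext fun u => (hB u).deriv
  refine ⟨_, contDiff_infty_iff_deriv.2 ⟨fun u => (hB u).differentiableAt, ?_⟩, hderiv⟩
  rwa [hderiv]

theorem sub_le_mul_sub_of_deriv_le {B : ℝ → ℝ} (hB : Differentiable ℝ B) {k x y : ℝ}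
    (hxy : x ≤ y) (h : ∀ u ∈ Set.Icc x y, deriv B u ≤ k) : B y - B x ≤ k * (y - x) :=
  (convex_Icc x y).image_sub_le_mul_sub_of_deriv_le hB.continuous.continuousOn
    hB.differentiableOn (fun u hu => h u (interior_subset hu)) x (Set.left_mem_Icc.2 hxy) y
    (Set.right_mem_Icc.2 hxy) hxy

theorem mul_sub_le_sub_of_le_deriv {B : ℝ → ℝ} (hB : Differentiable ℝ B) {k x y : ℝ}
    (hxy : x ≤ y) (h : ∀ u ∈ Set.Icc x y, k ≤ deriv B u) : k * (y - x) ≤ B y - B x :=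
  (convex_Icc x y).mul_sub_le_image_sub_of_le_deriv hB.continuous.continuousOn
    hB.differentiableOn (fun u hu => h u (interior_subset hu)) x (Set.left_mem_Icc.2 hxy) y
    (Set.right_mem_Icc.2 hxy) hxy

theorem exists_smooth_ramp {p s r t : ℝ} (hps : p < s) (hsr : s ≤ r) (hrt : r < t) :
    ∃ B : ℝ → ℝ, ContDiff ℝ ∞ B ∧ Monotone B ∧ (∀ u ∈ Set.Icc s r, deriv B u = 1) ∧
      (∀ u, B s - B u ≤ s - p) ∧ ∀ u, B u - B s ≤ t - s := by
  obtain ⟨β, hβ, hβ01, hβp, hβ1, hβt⟩ := exists_smooth_plateau hps hrt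
  obtain ⟨B, hB, rfl⟩ := exists_contDiff_deriv_eq hβ
  have hdiff : Differentiable ℝ B := hB.differentiable (by simp)
  have hmono : Monotone B := monotone_of_deriv_nonneg hdiff fun u => (hβ01 u).1
  have hlip : ∀ x y, x ≤ y → B y - B x ≤ y - x := fun x y hxy => by
    simpa using sub_le_mul_sub_of_deriv_le hdiff hxy fun u _ => (hβ01 u).2
  refine ⟨B, hB, hmono, hβ1, fun u => ?_, fun u => ?_⟩
  · rcases le_total p u with h | h
    · linarith [hlip p s hps.le, hmono h]
    · have : B p - B u ≤ 0 * (p - u) :=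
        sub_le_mul_sub_of_deriv_le hdiff h fun x hx => (hβp x hx.2).le
      linarith [hlip p s hps.le]
  · rcases le_total u t with h | h
    · linarith [hlip s t (hsr.trans hrt.le), hmono h]
    · have : B u - B t ≤ 0 * (u - t) :=
        sub_le_mul_sub_of_deriv_le hdiff h fun x hx => (hβt x hx.1).le
      linarith [hlip s t (hsr.trans hrt.le)]

/-- The functions and constants of a folding map. In strip coordinates the ellipsoid lies over the
base `0 < u < c + e`, with fibre of size `2 e + b (1 - u / c)` over `u`. The part over `u ≤ p` is
lifted by `C`, the base is stretched by `f`, which is so steep on `[s, r]` that the strip becomes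
thin there, and then folded at `s`; the fold takes up `2 κ`. Where `f' ≥ Λ (1 - C')` the stretched
strip has width less than `Λ⁻¹`, on `[s, r]` less than `N⁻¹`, and `Λ⁻¹ + N⁻¹ = 1`. -/
structure FoldProfile (b c ε : ℝ) where
  C : ℝ → ℝ
  f : ℝ → ℝ
  (e κ Λ N p s r : ℝ)
  e_pos : 0 < e
  κ_pos : 0 < κ
  holderConjugate : Λ.HolderConjugate N
  contDiff_C : ContDiff ℝ ∞ C
  antitone_C : Antitone C
  C_eq_of_le : ∀ u ≤ p, C u = b / 2
  C_eq_zero : ∀ u, s ≤ u → C u = 0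
  p_le_s : p ≤ s
  contDiff_f : ContDiff ℝ ∞ f
  le_deriv_f : ∀ u, Λ * (1 - deriv C u) ≤ deriv f u
  le_deriv_f_of_mem : ∀ u ∈ Set.Icc s r, N ≤ deriv f u
  f_s : f s = 0
  f_c_add_e_le : f (c + e) ≤ -f 0
  le_f_p_add_f_r : 2 * κ ≤ f p + f r
  fibre_p_le : 2 * e + b * (1 - p / c) ≤ b / 2
  total_le : ∀ u ≤ s, C u + (f u - f 0) + 2 * κ + (2 * e + b * (1 - u / c)) ≤ c / 2 + b + ε

/-- The stretch of a folding profile: slope about `Λ`, raised by about `N` where the ramp `B`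
rises. It absorbs the lift `C`, and vanishes at `s` if `C` does. -/
def foldStretch (Λ N s : ℝ) (C B : ℝ → ℝ) (u : ℝ) : ℝ := Λ * (u - C u - s) + N * (B u - B s)

theorem contDiff_foldStretch {Λ N s : ℝ} {C B : ℝ → ℝ} (hC : ContDiff ℝ ∞ C)
    (hB : ContDiff ℝ ∞ B) : ContDiff ℝ ∞ (foldStretch Λ N s C B) := by
  unfold foldStretch
  fun_prop

theorem deriv_foldStretch {Λ N s : ℝ} {C B : ℝ → ℝ} (hC : ContDiff ℝ ∞ C) (hB : ContDiff ℝ ∞ B)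
    (u : ℝ) : deriv (foldStretch Λ N s C B) u = Λ * (1 - deriv C u) + N * deriv B u :=
  ((((hasDerivAt_id u).sub (hasDerivAt_deriv hC u)).sub_const s).const_mul Λ).add
    (((hasDerivAt_deriv hB u).sub_const (B s)).const_mul N) |>.deriv

theorem foldStretch_le {Λ N s h η u : ℝ} {C B : ℝ → ℝ} (hΛ : 0 ≤ Λ) (hN : 0 ≤ N) (hC : h ≤ C u)
    (hB : B u - B s ≤ η) : foldStretch Λ N s C B u ≤ Λ * (u - h - s) + N * η := by
  rw [foldStretch]
  gcongr

theorem le_foldStretch {Λ N s h η u : ℝ} {C B : ℝ → ℝ} (hΛ : 0 ≤ Λ) (hN : 0 ≤ N) (hC : C u ≤ h)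
    (hB : B s - B u ≤ η) : Λ * (u - h - s) - N * η ≤ foldStretch Λ N s C B u := by
  rw [foldStretch, sub_eq_add_neg, ← mul_neg]
  gcongr
  linarith

theorem lift_add_foldStretch_sub_le {b c m Λ N s u θ : ℝ} {C B : ℝ → ℝ} (hΛ : 0 ≤ Λ - 1)
    (hN : 0 ≤ N) (hb : 0 ≤ b) (hc : 0 < c) (hbc : b ≤ c) (hm : 0 ≤ m) (hC0 : C 0 = b / 2)
    (hCu : 0 ≤ C u) (hB : B u - B 0 ≤ θ) (hu : u ≤ c / 2 + m) :
    C u + (foldStretch Λ N s C B u - foldStretch Λ N s C B 0) + b * (1 - u / c) ≤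
      (Λ - 1) * (c / 2 + m + b / 2) + N * θ + (c / 2 + m + b) := by
  have hbc' : 0 ≤ 1 - b / c := sub_nonneg.2 ((div_le_one hc).2 hbc)
  calc C u + (foldStretch Λ N s C B u - foldStretch Λ N s C B 0) + b * (1 - u / c)
      = (Λ - 1) * (u - C u + b / 2) + N * (B u - B 0) + (u * (1 - b / c) + 3 / 2 * b) := by
        simp only [foldStretch, hC0]
        ring
    _ ≤ (Λ - 1) * (c / 2 + m + b / 2) + N * θ + ((c / 2 + m) * (1 - b / c) + 3 / 2 * b) := by
        gcongr
        linarith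
    _ = (Λ - 1) * (c / 2 + m + b / 2) + N * θ + (c / 2 + m + b) - m * (b / c) := by
        field_simp
        ring
    _ ≤ (Λ - 1) * (c / 2 + m + b / 2) + N * θ + (c / 2 + m + b) :=
        sub_le_self _ (by positivity)

theorem nonempty_foldProfile_of_bounds {b c ε e κ Λ N m θ : ℝ} (hb : 0 ≤ b) (hbc : b ≤ c)
    (hc : 0 < c) (hΛN : Λ.HolderConjugate N) (he : 0 < e) (hκ : 0 < κ) (hm : 0 < m) (hθ : 0 < θ)
    (hem : 2 * e ≤ b / c * m) (hemθ : e + N * θ ≤ m)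
    (hΛ : 2 * κ + (Λ - 1) * (b / 2) + Λ * θ + N * θ ≤ m)
    (hε : m + θ + (Λ - 1) * (c / 2 + m + θ + b / 2) + N * θ + 2 * κ + 2 * e ≤ ε) :
    Nonempty (FoldProfile b c ε) := by
  have hΛ0 : 0 < Λ := hΛN.pos
  have hΛ1 : 0 < Λ - 1 := sub_pos.2 hΛN.lt
  have hN : 0 < N := hΛN.symm.pos
  obtain ⟨ℓ, hℓ, hNℓ⟩ : ∃ ℓ, 0 < ℓ ∧ N * ℓ = b / 2 + m :=
    ⟨(b / 2 + m) / N, by positivity, mul_div_cancel₀ _ hN.ne'⟩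
  obtain ⟨p, hp⟩ : ∃ p, p = c / 2 + m := ⟨_, rfl⟩
  obtain ⟨s, hs⟩ : ∃ s, s = p + θ := ⟨_, rfl⟩
  have hps : p < s := by linarith
  obtain ⟨C, hC, hCanti, hCmem, hCp, hCs⟩ := exists_smooth_step (div_nonneg hb zero_le_two) hps
  obtain ⟨B, hB, hBmono, hBderiv, hBlow, hBhigh⟩ :=
    exists_smooth_ramp hps (le_add_of_nonneg_right hℓ.le) (lt_add_of_pos_right (s + ℓ) hθ)
  have hC0 : C 0 = b / 2 := hCp 0 (by linarith)
  have hzero : foldStretch Λ N s C B 0 ≤ -(Λ * (b / 2 + s)) := by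
    linarith [foldStretch_le hΛ0.le hN.le hC0.ge (sub_nonpos.2 (hBmono (by linarith : 0 ≤ s)))]
  refine ⟨⟨C, foldStretch Λ N s C B, e, κ, Λ, N, p, s, s + ℓ, he, hκ, hΛN, hC, hCanti, hCp, hCs,
    hps.le, contDiff_foldStretch hC hB, fun u => ?_, fun u hu => ?_, ?_, ?_, ?_, ?_,
    fun u hu => ?_⟩⟩
  · rw [deriv_foldStretch hC hB]
    exact le_add_of_nonneg_right (mul_nonneg hN.le hBmono.deriv_nonneg)
  · rw [deriv_foldStretch hC hB, hBderiv u hu, mul_one]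
    exact le_add_of_nonneg_left (mul_nonneg hΛ0.le (by linarith [hCanti.deriv_nonpos (x := u)]))
  · simp [foldStretch, hCs s le_rfl]
  · have hend := foldStretch_le hΛ0.le hN.le (hCmem (c + e)).1 (hBhigh (c + e))
    have : 0 ≤ (Λ - 1) * (b / 2 + 2 * s - (c + e)) :=
      mul_nonneg hΛ1.le (by linarith [mul_pos hN hθ])
    linarith
  · have hlow := le_foldStretch hΛ0.le hN.le (hCp p le_rfl).le (hBlow p)
    have hrise := mul_sub_le_sub_of_le_deriv (hB.differentiable (by simp))
      (le_add_of_nonneg_right hℓ.le) fun u hu => (hBderiv u hu).ge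
    have hhigh : Λ * (s + ℓ - 0 - s) - N * -ℓ ≤ foldStretch Λ N s C B (s + ℓ) :=
      le_foldStretch hΛ0.le hN.le (hCs _ (by linarith)).le (by linarith)
    have := mul_pos hΛ0 hℓ
    subst hs
    linarith
  · have : b * (1 - p / c) = b / 2 - b / c * m := by
      rw [hp]
      field_simp
      ring
    linarith
  · have := lift_add_foldStretch_sub_le (m := m + θ) (s := s) (B := B) (θ := θ) hΛ1.le hN.le hb hc
      hbc (by positivity) hC0 (hCmem u).1 (by linarith [hBmono hu, hBlow 0]) (by linarith)
    linarith

theorem exists_holderConjugate_lt {δ : ℝ} (hδ : 0 < δ) :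
    ∃ Λ N : ℝ, Λ.HolderConjugate N ∧ Λ < 1 + δ :=
  ⟨1 + δ / 2, _, .conjExponent (by linarith), by linarith⟩

theorem nonempty_foldProfile {b c ε : ℝ} (hb : 0 < b) (hbc : b ≤ c) (hε : 0 < ε) :
    Nonempty (FoldProfile b c ε) := by
  have hc : 0 < c := hb.trans_le hbc
  obtain ⟨δ, hδ, hδ1, hδε⟩ : ∃ δ, 0 < δ ∧ δ ≤ 1 ∧ δ * (c / 2 + ε + b / 2) ≤ ε / 8 :=
    ⟨min 1 (ε / 8 / (c / 2 + ε + b / 2)), by positivity, min_le_left _ _,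
      (le_div_iff₀ (by positivity)).1 (min_le_right _ _)⟩
  obtain ⟨Λ, N, hΛN, hΛ⟩ := exists_holderConjugate_lt hδ
  have hΛ1 : 1 < Λ := hΛN.lt
  have hN : 1 < N := hΛN.symm.lt
  obtain ⟨θ, hθ, hNθ⟩ : ∃ θ, 0 < θ ∧ N * θ = ε / 32 :=
    ⟨ε / 32 / N, by positivity, mul_div_cancel₀ _ (by positivity)⟩
  have hθε : θ ≤ ε / 32 := by nlinarith
  have hslope : ∀ x ≤ c / 2 + ε + b / 2, (Λ - 1) * x ≤ ε / 8 := fun x hx => by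
    calc (Λ - 1) * x ≤ (Λ - 1) * (c / 2 + ε + b / 2) := by gcongr
      _ ≤ δ * (c / 2 + ε + b / 2) := by gcongr; linarith
      _ ≤ ε / 8 := hδε
  have hbcε : b / c * (ε / 16) ≤ ε / 16 :=
    mul_le_of_le_one_left (by positivity) ((div_le_one hc).2 hbc)
  refine nonempty_foldProfile_of_bounds (m := ε / 2) (e := b / c * (ε / 16)) (κ := ε / 32)
    hb.le hbc hc hΛN (by positivity) (by positivity) (by positivity) hθ ?_ ?_ ?_ ?_
  · have : 0 < b / c * ε := by positivity
    linarith
  · linarith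
  · have := hslope (b / 2) (by linarith)
    have : Λ * θ ≤ 2 * θ := by gcongr; linarith
    linarith
  · have := hslope (c / 2 + ε / 2 + θ + b / 2) (by linarith)
    linarith

end Profile

/-! ### The folding map -/

/-- The ellipsoid in strip coordinates, with room `2 e` in the fibres and `e` in the base for the
error made by these coordinates. -/
def foldDomain (b c e : ℝ) : Set (ℂ × ℂ) :=
  {z | 0 < z.1.re ∧ z.1.im ∈ Set.Ioo 0 1 ∧ z.2.re ∈ Set.Ioo 0 (c + e) ∧ z.2.im ∈ Set.Ioo 0 1 ∧
    z.1.re < 2 * e + b * (1 - z.2.re / c)}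

namespace FoldProfile

variable {b c ε : ℝ} (F : FoldProfile b c ε) {z z' : ℂ × ℂ}

theorem deriv_C_nonpos (u : ℝ) : deriv F.C u ≤ 0 := F.antitone_C.deriv_nonpos

theorem C_nonneg (u : ℝ) : 0 ≤ F.C u := by
  rw [← F.C_eq_zero _ (le_max_left F.s u)]
  exact F.antitone_C (le_max_right F.s u)

theorem deriv_C_eq_zero {u : ℝ} (hu : F.s ≤ u) : deriv F.C u = 0 :=
  IsLocalMin.deriv_eq_zero <| .of_forall fun x => (F.C_eq_zero u hu).trans_le (F.C_nonneg x)

theorem deriv_f_pos (u : ℝ) : 0 < deriv F.f u :=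
  (mul_pos F.holderConjugate.pos (by linarith [F.deriv_C_nonpos u])).trans_le (F.le_deriv_f u)

theorem strictMono_f : StrictMono F.f := strictMono_of_deriv_pos F.deriv_f_pos

/-- The base coordinates after lifting and stretching, before the fold. -/
noncomputable def base (z : ℂ × ℂ) : ℂ := stretch F.f (liftShear F.C z).2

/-- The folding map in strip coordinates: lift, stretch the base, fold it, and move the result to
the right half plane. -/
noncomputable def map (z : ℂ × ℂ) : ℂ × ℂ :=
  ((liftShear F.C z).1, ((-F.f 0 : ℝ) : ℂ) + fold F.κ (F.base z))

theorem im_base_mul_deriv (z : ℂ × ℂ) :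
    (F.base z).im * deriv F.f z.2.re = z.2.im - deriv F.C z.2.re * z.1.im :=
  div_mul_cancel₀ _ (F.deriv_f_pos _).ne'

theorem im_base_pos (hz : z ∈ foldDomain b c F.e) : 0 < (F.base z).im := by
  obtain ⟨-, ⟨hy, -⟩, -, ⟨hv, -⟩, -⟩ := hz
  have hshear := mul_nonpos_of_nonpos_of_nonneg (F.deriv_C_nonpos z.2.re) hy.le
  exact div_pos (sub_pos.2 (hshear.trans_lt hv)) (F.deriv_f_pos _)

theorem im_base_lt_inv_Λ (hz : z ∈ foldDomain b c F.e) : (F.base z).im < F.Λ⁻¹ := by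
  obtain ⟨-, ⟨-, hy⟩, -, ⟨-, hv⟩, -⟩ := id hz
  have hC := F.deriv_C_nonpos z.2.re
  rw [← one_div, lt_div_iff₀' F.holderConjugate.pos]
  refine lt_of_mul_lt_mul_right ?_ (by linarith : 0 ≤ 1 - deriv F.C z.2.re)
  calc F.Λ * (F.base z).im * (1 - deriv F.C z.2.re)
      = (F.base z).im * (F.Λ * (1 - deriv F.C z.2.re)) := by ring
    _ ≤ (F.base z).im * deriv F.f z.2.re := by
        gcongr
        exacts [(F.im_base_pos hz).le, F.le_deriv_f _]
    _ < 1 * (1 - deriv F.C z.2.re) := by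
        rw [F.im_base_mul_deriv]
        nlinarith

theorem im_base_lt_inv_N (hz : z ∈ foldDomain b c F.e) (hu : z.2.re ∈ Set.Icc F.s F.r) :
    (F.base z).im < F.N⁻¹ := by
  have hv := hz.2.2.2.1.2
  rw [← one_div, lt_div_iff₀ F.holderConjugate.symm.pos]
  calc (F.base z).im * F.N ≤ (F.base z).im * deriv F.f z.2.re := by
        gcongr
        exacts [(F.im_base_pos hz).le, F.le_deriv_f_of_mem _ hu]
    _ < 1 := by simpa [F.im_base_mul_deriv, F.deriv_C_eq_zero hu.1] using hv

theorem im_base_lt_one (hz : z ∈ foldDomain b c F.e) : (F.base z).im < 1 :=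
  (F.im_base_lt_inv_Λ hz).trans (inv_lt_one_of_one_lt₀ F.holderConjugate.lt)

theorem re_map_fst (z : ℂ × ℂ) : (F.map z).1.re = z.1.re + F.C z.2.re := rfl

theorem re_map_snd (z : ℂ × ℂ) : (F.map z).2.re = -F.f 0 + (fold F.κ (F.base z)).re := by
  simp only [map, Complex.add_re, Complex.ofReal_re]

theorem im_map_snd (z : ℂ × ℂ) : (F.map z).2.im = (fold F.κ (F.base z)).im := by
  simp only [map, Complex.add_im, Complex.ofReal_im, zero_add]

theorem le_re_map_snd (hz : z ∈ foldDomain b c F.e) : -F.f 0 - |F.f z.2.re| ≤ (F.map z).2.re := by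
  rw [F.re_map_snd, sub_eq_add_neg]
  gcongr
  exact neg_abs_le_re_fold F.κ_pos (F.im_base_pos hz)

theorem re_map_snd_le (hz : z ∈ foldDomain b c F.e) :
    (F.map z).2.re ≤ -F.f 0 - |F.f z.2.re| + 2 * F.κ := by
  have hfold : _ ≤ -|F.f z.2.re| + _ := re_fold_le F.κ_pos (F.im_base_pos hz)
  have := mul_le_of_le_one_right F.κ_pos.le (F.im_base_lt_one hz).le
  rw [F.re_map_snd]
  linarith

theorem pullsBackAt_map (hz : z ∈ foldDomain b c F.e) :
    PullsBackAt F.map prodForm prodForm z := by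
  have hbase := pullsBackAt_stretch F.contDiff_f (F.deriv_f_pos (liftShear F.C z).2.re)
  have hfold := (pullsBackAt_fold F.κ_pos (F.im_base_pos hz)).comp (f := stretch F.f) hbase
  exact (pullsBackAt_id.prodMap (hfold.const_add _)).comp (f := liftShear F.C)
    (pullsBackAt_liftShear F.contDiff_C z)

theorem re_map_fst_pos (hz : z ∈ foldDomain b c F.e) : 0 < (F.map z).1.re :=
  add_pos_of_pos_of_nonneg hz.1 (F.C_nonneg _)

theorem re_map_snd_pos (hz : z ∈ foldDomain b c F.e) : 0 < (F.map z).2.re := by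
  obtain ⟨hu, hu'⟩ := hz.2.2.1
  refine lt_of_lt_of_le (sub_pos.2 (abs_lt.2 ⟨?_, ?_⟩)) (F.le_re_map_snd hz)
  · rw [neg_neg]
    exact F.strictMono_f hu
  · exact (F.strictMono_f hu').trans_le F.f_c_add_e_le

theorem re_map_add_re_map_add_le (hb : 0 ≤ b) (hc : 0 ≤ c) (hz : z ∈ foldDomain b c F.e) :
    (F.map z).1.re + (F.map z).2.re + (2 * F.e + b * (1 - z.2.re / c) - z.1.re) ≤
      c / 2 + b + ε := by
  have hre := F.re_map_snd_le hz
  rw [F.re_map_fst]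
  rcases le_total z.2.re F.s with hu | hu
  · linarith [F.total_le _ hu, neg_abs_le (F.f z.2.re)]
  · have hs := F.total_le _ le_rfl
    have hfibre : b * (1 - z.2.re / c) ≤ b * (1 - F.s / c) := by gcongr
    rw [F.C_eq_zero _ le_rfl, F.f_s] at hs
    rw [F.C_eq_zero _ hu]
    linarith [abs_nonneg (F.f z.2.re)]

theorem im_map_snd_ne_add_one (hb : 0 ≤ b) (hc : 0 ≤ c) (hz : z ∈ foldDomain b c F.e)
    (hz' : z' ∈ foldDomain b c F.e) (hfst : (F.map z).1.re = (F.map z').1.re)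
    (hsnd : (F.map z).2.re = (F.map z').2.re) : (F.map z).2.im ≠ (F.map z').2.im + 1 := by
  -- Such points lie on opposite sides of the fold, so by `Λ⁻¹ + N⁻¹ = 1` the second one lies over
  -- `u > r`. The lift separates the fibres if `u ≤ p` for the first one, and the radius if not.
  intro him
  rw [F.im_map_snd, F.im_map_snd] at him
  have hV := abs_lt.1 (abs_im_fold_lt F.κ_pos (F.im_base_pos hz))
  have hV' := abs_lt.1 (abs_im_fold_lt F.κ_pos (F.im_base_pos hz'))
  have hw := F.im_base_lt_one hz
  have hw' := F.im_base_lt_one hz'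
  have hneg : F.f z.2.re < F.f F.s :=
    F.f_s ▸ (im_fold_pos_iff F.κ_pos (F.im_base_pos hz)).1 (by linarith)
  have hpos : F.f F.s < F.f z'.2.re :=
    F.f_s ▸ (im_fold_neg_iff F.κ_pos (F.im_base_pos hz')).1 (by linarith)
  have hs' : F.s < z'.2.re := F.strictMono_f.lt_iff_lt.1 hpos
  have hr' : F.r < z'.2.re := by
    by_contra! h
    linarith [F.im_base_lt_inv_Λ hz, F.im_base_lt_inv_N hz' ⟨hs'.le, h⟩,
      F.holderConjugate.inv_add_inv_eq_one]
  rcases le_or_gt z.2.re F.p with hp | hp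
  · rw [F.re_map_fst, F.re_map_fst, F.C_eq_of_le _ hp, F.C_eq_zero _ hs'.le] at hfst
    have hx' := hz'.2.2.2.2
    have : b * (1 - z'.2.re / c) ≤ b * (1 - F.p / c) := by
      gcongr
      exact F.p_le_s.trans hs'.le
    linarith [hz.1, F.fibre_p_le]
  · have hlow := F.le_re_map_snd hz
    have hhigh := F.re_map_snd_le hz'
    rw [F.f_s] at hneg hpos
    rw [abs_of_neg hneg] at hlow
    rw [abs_of_pos hpos] at hhigh
    linarith [F.strictMono_f hp, F.strictMono_f hr', F.le_f_p_add_f_r]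

theorem injOn_map : (foldDomain b c F.e).InjOn F.map := by
  intro z hz z' hz' h
  have hbase : F.base z = F.base z' :=
    injOn_fold F.κ_pos (F.im_base_pos hz) (F.im_base_pos hz') (add_left_cancel (Prod.ext_iff.1 h).2)
  have hu : z.2.re = z'.2.re := F.strictMono_f.injective (congrArg Complex.re hbase)
  have hy : z.1.im = z'.1.im := congrArg (fun w => w.1.im) h
  have hx : z.1.re + F.C z.2.re = z'.1.re + F.C z'.2.re := congrArg (fun w => w.1.re) h
  have hv := F.im_base_mul_deriv z
  rw [hbase, hu, F.im_base_mul_deriv, hy] at hv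
  rw [hu] at hx
  exact Prod.ext (Complex.ext (add_right_cancel hx) hy)
    (Complex.ext hu (sub_left_injective hv).symm)

theorem injOn_ofPolar_map (hb : 0 ≤ b) (hc : 0 ≤ c) :
    (foldDomain b c F.e).InjOn fun z => ((F.map z).1, ofPolar (F.map z).2) := by
  intro z hz z' hz' h
  obtain ⟨hfst, hsnd⟩ := Prod.ext_iff.1 h
  obtain ⟨hre, m, him⟩ := re_eq_and_exists_im_eq_of_ofPolar_eq (F.re_map_snd_pos hz)
    (F.re_map_snd_pos hz') hsnd
  have hV := abs_lt.1 (abs_im_fold_lt F.κ_pos (F.im_base_pos hz))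
  have hV' := abs_lt.1 (abs_im_fold_lt F.κ_pos (F.im_base_pos hz'))
  rw [← F.im_map_snd] at hV hV'
  have hw := F.im_base_lt_one hz
  have hw' := F.im_base_lt_one hz'
  have hm2 : m < 2 := by exact_mod_cast (by linarith : (m : ℝ) < 2)
  have hm2' : -2 < m := by exact_mod_cast (by linarith : (-2 : ℝ) < m)
  obtain rfl | rfl | rfl : m = -1 ∨ m = 0 ∨ m = 1 := by omega
  · refine (F.im_map_snd_ne_add_one hb hc hz' hz (congrArg Complex.re hfst.symm) hre.symm ?_).elim
    push_cast at him
    linarith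
  · refine F.injOn_map hz hz' (Prod.ext hfst (Complex.ext hre ?_))
    simpa using him
  · refine (F.im_map_snd_ne_add_one hb hc hz hz' (congrArg Complex.re hfst) hre ?_).elim
    simpa using him

end FoldProfile

/-! ### Folding ellipsoids -/

/-- The ellipsoid `E⁴(b, c)`, as a subset of `ℂ × ℂ`. -/
def ellipsoidProd (b c : ℝ) : Set (ℂ × ℂ) :=
  {z | Real.pi * ‖z.1‖ ^ 2 / b + Real.pi * ‖z.2‖ ^ 2 / c < 1}

theorem add_mul_one_sub_le {b c e x u X U : ℝ} (hb : 0 < b) (hbc : b ≤ c) (he : 0 ≤ e)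
    (hX : X ≤ x + e) (hU : U ≤ u + e) :
    X + b * (1 - (x / b + u / c)) ≤ 2 * e + b * (1 - U / c) := by
  have hc : 0 < c := hb.trans_le hbc
  calc X + b * (1 - (x / b + u / c)) = X - x + b - b / c * u := by
        field_simp
        ring
    _ ≤ e + b - b / c * (U - e) := by
        gcongr <;> linarith
    _ = e + b / c * e + b * (1 - U / c) := by ring
    _ ≤ 2 * e + b * (1 - U / c) := by
        linarith [mul_le_of_le_one_left he ((div_le_one hc).2 hbc)]

theorem norm_le_of_mem_ellipsoidProd {b c : ℝ} (hb : 0 < b) (hbc : b ≤ c) {z : ℂ × ℂ}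
    (hz : z ∈ ellipsoidProd b c) : ‖z.1‖ ≤ √(c / Real.pi) ∧ ‖z.2‖ ≤ √(c / Real.pi) := by
  have hc : 0 < c := hb.trans_le hbc
  have hz₁ : 0 ≤ Real.pi * ‖z.1‖ ^ 2 / b := by positivity
  have hz₂ : 0 ≤ Real.pi * ‖z.2‖ ^ 2 / c := by positivity
  have hz : Real.pi * ‖z.1‖ ^ 2 / b + Real.pi * ‖z.2‖ ^ 2 / c < 1 := hz
  refine ⟨Real.le_sqrt_of_sq_le ?_, Real.le_sqrt_of_sq_le ?_⟩ <;> rw [le_div_iff₀' Real.pi_pos]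
  · exact ((div_le_one hb).1 (by linarith)).trans hbc
  · exact (div_le_one hc).1 (by linarith)

/-- The last summand on the left leaves room for the other coordinates of a point in a higher
dimensional ellipsoid. -/
theorem exists_symplectic_fold {b c ε : ℝ} (hb : 0 < b) (hbc : b ≤ c) (hε : 0 < ε) :
    ∃ Φ : ℂ × ℂ → ℂ × ℂ, (∀ z ∈ ellipsoidProd b c, PullsBackAt Φ prodForm prodForm z) ∧
      (ellipsoidProd b c).InjOn Φ ∧ ∀ z ∈ ellipsoidProd b c,
        Real.pi * ‖(Φ z).1‖ ^ 2 + Real.pi * ‖(Φ z).2‖ ^ 2 +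
          b * (1 - (Real.pi * ‖z.1‖ ^ 2 / b + Real.pi * ‖z.2‖ ^ 2 / c)) ≤ c / 2 + b + ε := by
  have hc : 0 < c := hb.trans_le hbc
  obtain ⟨F⟩ := nonempty_foldProfile hb hbc hε
  obtain ⟨P, hP, hPinj, hPmem⟩ := exists_strip_coordinate (Real.sqrt_nonneg (c / Real.pi)) F.e_pos
  have hfibre : ∀ z ∈ ellipsoidProd b c, (P z.1).re +
      b * (1 - (Real.pi * ‖z.1‖ ^ 2 / b + Real.pi * ‖z.2‖ ^ 2 / c)) ≤
        2 * F.e + b * (1 - (P z.2).re / c) := fun z hz => by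
    obtain ⟨hR₁, hR₂⟩ := norm_le_of_mem_ellipsoidProd hb hbc hz
    exact add_mul_one_sub_le hb hbc F.e_pos.le ((hPmem z.1).2.2 hR₁) ((hPmem z.2).2.2 hR₂)
  have hdom : ∀ z ∈ ellipsoidProd b c, Prod.map P P z ∈ foldDomain b c F.e := fun z hz => by
    obtain ⟨hx, hy, -⟩ := hPmem z.1
    obtain ⟨hu, hv, huR⟩ := hPmem z.2
    have hpos : 0 < b * (1 - (Real.pi * ‖z.1‖ ^ 2 / b + Real.pi * ‖z.2‖ ^ 2 / c)) :=
      mul_pos hb (sub_pos.2 hz)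
    have hz₁ : 0 ≤ Real.pi * ‖z.1‖ ^ 2 / b := by positivity
    have hz₂ : Real.pi * ‖z.2‖ ^ 2 < c :=
      (div_lt_one hc).1 (by linarith [show _ + _ < (1 : ℝ) from hz])
    have := huR (norm_le_of_mem_ellipsoidProd hb hbc hz).2
    exact ⟨hx, hy, ⟨hu, this.trans_lt (by gcongr)⟩, hv,
      show (P z.1).re < 2 * F.e + b * (1 - (P z.2).re / c) by linarith [hfibre z hz]⟩
  refine ⟨Prod.map ofPolar ofPolar ∘ F.map ∘ Prod.map P P, fun z hz => ?_, fun z hz z' hz' h => ?_,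
    fun z hz => ?_⟩
  · have hpolar := (pullsBackAt_ofPolar (F.re_map_fst_pos (hdom z hz))).prodMap
      (pullsBackAt_ofPolar (F.re_map_snd_pos (hdom z hz)))
    have hmap := (F.pullsBackAt_map (hdom z hz)).comp (f := Prod.map P P)
      ((hP z.1).prodMap (hP z.2))
    exact PullsBackAt.comp (f := F.map ∘ Prod.map P P) hpolar hmap
  · obtain ⟨hfst, hsnd⟩ := Prod.ext_iff.1 h
    have hy := (hdom z hz).2.1
    have hy' := (hdom z' hz').2.1
    have hfst' := injOn_ofPolar ⟨F.re_map_fst_pos (hdom z hz), hy⟩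
      ⟨F.re_map_fst_pos (hdom z' hz'), hy'⟩ hfst
    exact hPinj.prodMap hPinj <| F.injOn_ofPolar_map hb.le hc.le (hdom z hz) (hdom z' hz') <|
      Prod.ext hfst' hsnd
  · have hmoment := F.re_map_add_re_map_add_le hb.le hc.le (hdom z hz)
    simp only [Function.comp_apply, Prod.map_fst, Prod.map_snd] at hmoment ⊢
    rw [pi_mul_norm_ofPolar_sq (F.re_map_fst_pos (hdom z hz)).le,
      pi_mul_norm_ofPolar_sq (F.re_map_snd_pos (hdom z hz)).le]
    linarith [hfibre z hz]

theorem sum_div_add_le {ι : Type*} [Fintype ι] [DecidableEq ι] {i j : ι} {a x : ι → ℝ}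
    (hij : i ≠ j) (ha : ∀ k, 0 < a k) (hai : ∀ k ≠ j, a k ≤ a i) (hx : ∀ k, 0 ≤ x k) :
    x i / a i + x j / a j + (∑ k ∈ (Finset.univ.erase i).erase j, x k) / a i ≤
      ∑ k, x k / a k := by
  rw [sum_eq_add_add_sum_erase hij, Finset.sum_div]
  gcongr with k hk
  exacts [hx k, ha k, hai k (Finset.ne_of_mem_erase hk)]

end SymplecticFolding

open SymplecticFolding in
theorem mainTheorem2_general {n : ℕ} {i j : Fin n} (hij : i ≠ j) {a : Fin n → ℝ}
    (ha : ∀ k, 0 < a k) (hai : ∀ k ≠ j, a k ≤ a i) (haij : a i ≤ a j) {ε : ℝ} (hε : 0 < ε) :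
    SymplecticallyEmbeds (ellipsoid a) (ball n (a j / 2 + a i + ε)) := by
  have hi := ha i
  have hj := ha j
  obtain ⟨Φ, hΦ, hinj, hmoment⟩ := exists_symplectic_fold hi haij hε
  have hsplit (z : Fin n → ℂ) :=
    sum_div_add_le (x := fun k => Real.pi * ‖z k‖ ^ 2) hij ha hai fun k => by positivity
  have hpair : ∀ z ∈ ellipsoid a, (z i, z j) ∈ ellipsoidProd (a i) (a j) := fun z hz => by
    refine lt_of_le_of_lt (le_add_of_nonneg_right ?_) ((hsplit z).trans_lt hz)
    positivity
  refine ⟨mapPair i j Φ, isSymplecticEmbedding_of_pullsBackAt (isOpen_ellipsoid a)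
    (fun z hz => (hΦ _ (hpair z hz)).mapPair hij) ((injOn_mapPair hij hinj).mono hpair)
    fun z hz => ?_⟩
  have hrest := (hsplit z).trans_lt hz
  rw [← lt_sub_iff_add_lt', div_lt_iff₀' hi] at hrest
  have hbound := hmoment _ (hpair z hz)
  change ∑ k, _ < (1 : ℝ)
  rw [← Finset.sum_div, div_lt_one (by positivity), sum_eq_add_add_sum_erase hij, mapPair_left,
    mapPair_right hij, Finset.sum_congr rfl fun k hk => by
      rw [mapPair_of_ne (Finset.ne_of_mem_erase (Finset.mem_of_mem_erase hk))
        (Finset.ne_of_mem_erase hk)]]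
  linarith

namespace SymplecticFolding

theorem ellipsoidLast_symplecticallyEmbeds_ball {n : ℕ} (hn : 2 ≤ n) {b c ε : ℝ} (hb : 0 < b)
    (hbc : b ≤ c) (hε : 0 < ε) :
    SymplecticallyEmbeds (ellipsoidLast n b c) (ball n (c / 2 + b + ε)) := by
  obtain ⟨m, rfl⟩ := Nat.exists_eq_add_of_le' hn
  have hlast (k : Fin (m + 2)) : (k : ℕ) + 1 = m + 2 ↔ k = Fin.last (m + 1) := by
    rw [Fin.ext_iff, Fin.val_last, Nat.add_right_cancel_iff]
  have hne : (0 : Fin (m + 2)) ≠ Fin.last (m + 1) := Fin.last_pos.ne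
  have key := mainTheorem2_general (a := fun k => if k = Fin.last (m + 1) then c else b) hne
    (fun k => by split_ifs; exacts [hb.trans_le hbc, hb])
    (fun k hk => by rw [if_neg hk, if_neg hne]) (by rwa [if_pos rfl, if_neg hne]) hε
  rw [if_pos rfl, if_neg hne] at key
  simpa only [ellipsoidLast, hlast] using key

end SymplecticFolding

theorem mainTheorem2 (n : ℕ) (hn : 2 ≤ n) :
    (∀ a ε : ℝ, 2 * Real.pi < a → 0 < ε →
      SymplecticFolding.SymplecticallyEmbeds
        (SymplecticFolding.ellipsoidLast n Real.pi a)
        (SymplecticFolding.ball n (a / 2 + Real.pi + ε))) ∧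
    (∀ b c : ℝ, 0 < b → 2 * b < c →
      ∃ A : ℝ, 0 < A ∧ A < c ∧
        SymplecticFolding.SymplecticallyEmbeds
          (SymplecticFolding.ellipsoidLast n b c)
          (SymplecticFolding.ball n A)) := by
  refine ⟨fun a ε ha hε => SymplecticFolding.ellipsoidLast_symplecticallyEmbeds_ball hn
      Real.pi_pos (by linarith [Real.pi_pos]) hε,
    fun b c hb hbc => ⟨c / 2 + b + (c / 2 - b) / 2, by linarith, by linarith,
      SymplecticFolding.ellipsoidLast_symplecticallyEmbeds_ball hn hb (by linarith)
        (by linarith)⟩⟩
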